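/- Notation. For $n\ge 1$ let $S^{n-1}$ be the unit sphere of $\mathbb{R}^n$ and let $du$ denote $(n-1)$-dimensional Hausdorff (spherical Lebesgue) measure on it. For $v\in S^{n-1}$ and $0<\varepsilon<1$ put $\Sigma_\varepsilon(v)=\{u\in S^{n-1}:\langle u,v\rangle\ge\varepsilon\}$. Let $\mathcal{K}_o^n$ be the set of compact convex sets in $\mathbb{R}^n$ with the origin $o$ in their interiors. For $K\in\mathcal{K}_o^n$ let $h_K(u)=\sup_{x\in K}\langle u,x\rangle$ be its support function, $\rho_K(u)=\sup\{\lambda>0:\lambda u\in K\}$ its radial function, $H(K,u)=\{x\in\mathbb{R}^n:\langle x,u\rangle=h_K(u)\}$ its supporting hyperplane in the direction $u\in S^{n-1}$, and, for almost all $u\in S^{n-1}$, let $\alpha_K(u)$ be the unique outer unit normal vector of $K$ at the boundary point $\rho_K(u)u$. For $E\subset S^{n-1}$ let $$\boldsymbol{\alpha}^*_K(E)=\{x/|x| : x\in\partial K\cap H(K,v)\text{ for some }v\in E\}.$$ For $G:(0,\infty)\times S^{n-1}\to\mathbb{R}$ with continuous partial derivative $G_t(t,u)=\partial G(t,u)/\partial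 t$ and continuous $\psi:(0,\infty)\to(0,\infty)$, the general dual Orlicz curvature measure of $K$ is the finite signed measure $$\widetilde{C}_{G,\psi}(K,E)=\frac1n\int_{\boldsymbol{\alpha}^*_K(E)}\frac{\rho_K(u)\,G_t(\rho_K(u),u)}{\psi(h_K(\alpha_K(u)))}\,du,\qquad E\subset S^{n-1}\ \text{Borel}.$$ A star body is a bounded set $Q\subset\mathbb{R}^n$ with $o\in Q$ and $\lambda x\in Q$ for $x\in Q$, $\lambda\in[0,1]$, whose radial function $\rho_Q(u)=\sup\{\lambda>0:\lambda u\in Q\}$ is positive and continuous on $S^{n-1}$. For $p,q\in\mathbb{R}$, the $(p,q)$-dual curvature measure of $K$ relative to $Q$ is $$\widetilde{C}_{p,q}(K,Q,E)=\frac1n\int_{\boldsymbol{\alpha}^*_K(E)}h_K(\alpha_K(u))^{-p}\rho_K(u)^q\rho_Q(u)^{n-q}\,du,\qquad E\subset S^{n-1}\ \text{Borel}.$$ Theorem. Let $\mu$ be a nonzero finite Borel measure on $S^{n-1}$ not concentrated on any closed hemisphere, that is, $\int_{S^{n-1}}\max\{\langle u,v\rangle,0\}\,d\mu(u)>0$ for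 all $v\in S^{n-1}$. Write $|\mu|=\mu(S^{n-1})$. (i) Let $G:(0,\infty)\times S^{n-1}\to\mathbb{R}$ be such that $G$ and $G_t$ are continuous and $G_t<0$ on $(0,\infty)\times S^{n-1}$. Let $0<\varepsilon_0<1$ and suppose that for all $v\in S^{n-1}$ and $0<\varepsilon\le\varepsilon_0$, $$\lim_{t\to0+}\int_{\Sigma_\varepsilon(v)}G(t,u)\,du=\infty\qquad\text{and}\qquad\lim_{t\to\infty}\int_{S^{n-1}}G(t,u)\,du=0.$$ Let $\psi:(0,\infty)\to(0,\infty)$ be continuous with $\int_1^\infty\frac{\psi(s)}{s}\,ds=\infty$. Then there exists $K\in\mathcal{K}_o^n$ such that $\widetilde{C}_{G,\psi}(K,S^{n-1})\ne0$ and, as measures on the Borel subsets of $S^{n-1}$, $$\frac{\mu}{|\mu|}=\frac{\widetilde{C}_{G,\psi}(K,\cdot)}{\widetilde{C}_{G,\psi}(K,S^{n-1})}.$$ (ii) Let $p>0$, let $q<0$, and let $Q$ be a star body in $\mathbb{R}^n$. Then there exists $K\in\mathcal{K}_o^n$ such that $\mu=\widetilde{C}_{p,q}(K,Q,\cdot)$.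 -/

import Mathlib

open Set Filter Topology MeasureTheory

noncomputable section

namespace DualOrlicz

/-- Euclidean space `ℝⁿ`. -/
abbrev E (n : ℕ) : Type := EuclideanSpace ℝ (Fin n)

/-- The unit sphere `S^{n-1}` of `ℝⁿ`. -/
abbrev Sph (n : ℕ) : Type := Metric.sphere (0 : E n) 1

variable {n : ℕ}

/-- The spherical Lebesgue measure `du` on `S^{n-1}`, that is, `(n-1)`-dimensional Hausdorff measure
with the usual normalization (the surface area measure of polar coordinates;
counting measure on the two points of `S^0` if `n = 1`). -/
def sphMeasure (n : ℕ) : Measure (Sph n) := (volume : Measure (E n)).toSphere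

/-- The class `𝒦ₒⁿ`: compact convex sets having the origin in their interiors. -/
def IsKo (K : ConvexBody (E n)) : Prop := (0 : E n) ∈ interior (K : Set (E n))

/-- The support function `h_K(u) = sup {⟨u, x⟩ : x ∈ K}`. -/
def suppFun (K : Set (E n)) (u : E n) : ℝ := sSup ((fun x => inner ℝ u x) '' K)

/-- The radial function `ρ_L(x) = sup {r > 0 : r x ∈ L}`. -/
def radFun (L : Set (E n)) (x : E n) : ℝ := sSup {r : ℝ | 0 < r ∧ r • x ∈ L}

/-- The supporting hyperplane `H(K, u)` in direction `u`. -/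
def suppPlane (K : Set (E n)) (u : E n) : Set (E n) := {x | inner ℝ x u = suppFun K u}

/-- The multivalued Gauss map: the set of outer unit normals of `K` at the points of `F ⊆ ∂K`. -/
def normalSet (K : Set (E n)) (F : Set (E n)) : Set (Sph n) := {v | ∃ x ∈ F, x ∈ suppPlane K v}

/-- The multivalued radial Gauss map: the set of outer unit normals of `K` at the boundary points
`ρ_K(u) u` with `u ∈ A`. -/
def radGaussSet (K : Set (E n)) (A : Set (Sph n)) : Set (Sph n) :=
  normalSet K ((fun u : Sph n => radFun K (u : E n) • (u : E n)) '' A)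

/-- The reverse radial Gauss image of `A`: the set of directions `x / |x|` of the points
`x ∈ ∂K ∩ H(K, v)` with `v ∈ A`. -/
def revRadGaussSet (K : Set (E n)) (A : Set (Sph n)) : Set (Sph n) :=
  {w | ∃ v ∈ A, ∃ x ∈ frontier K ∩ suppPlane K v, (w : E n) = ‖x‖⁻¹ • x}

open Classical in
/-- The radial Gauss map `α_K`: the unique outer unit normal of `K` at `ρ_K(u) u` where it is
unique, which for a convex body with the origin in its interior is the case for almost all `u`
(elsewhere the value is immaterial). -/
def radGauss (K : Set (E n)) (u : Sph n) : Sph n :=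
  if h : ∃ v, radGaussSet K {u} = {v} then h.choose else u

/-- The partial derivative `G_t(t, u) = ∂G(t, u) / ∂t`. -/
def partialT (G : ℝ → Sph n → ℝ) (t : ℝ) (u : Sph n) : ℝ := deriv (fun s => G s u) t

/-- The general dual Orlicz curvature measure `C̃_{G,ψ}(K, A)` of a Borel set `A ⊆ S^{n-1}`. -/
def curvMeasure (G : ℝ → Sph n → ℝ) (ψ : ℝ → ℝ) (K : Set (E n)) (A : Set (Sph n)) : ℝ :=
  (1 / (n : ℝ)) * ∫ u in revRadGaussSet K A,
    radFun K u * partialT G (radFun K u) u / ψ (suppFun K (radGauss K u)) ∂(sphMeasure n)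

/-- The `(p,q)`-dual curvature measure `C̃_{p,q}(K, Q, A)` of `K` relative to `Q`, of a Borel set
`A ⊆ S^{n-1}`. -/
def pqCurvMeasure (p q : ℝ) (K Q : Set (E n)) (A : Set (Sph n)) : ℝ :=
  (1 / (n : ℝ)) * ∫ u in revRadGaussSet K A,
    suppFun K (radGauss K u) ^ (-p) * radFun K u ^ q * radFun Q u ^ ((n : ℝ) - q) ∂(sphMeasure n)

/-- Star bodies: sets that are star-shaped about the origin with a positive, continuous (real valued)
radial function on the sphere. -/
structure IsStarBody (Q : Set (E n)) : Prop where
  zero_mem : (0 : E n) ∈ Q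
  smul_mem : ∀ x ∈ Q, ∀ r ∈ Icc (0 : ℝ) 1, r • x ∈ Q
  bounded : Bornology.IsBounded Q
  radFun_pos : ∀ u : Sph n, 0 < radFun Q u
  radFun_cont : Continuous (fun u : Sph n => radFun Q u)

/-- The spherical cap `Σ_ε(v) = {u ∈ S^{n-1} : ⟨u, v⟩ ≥ ε}`. -/
def cap (ε : ℝ) (v : Sph n) : Set (Sph n) := {u | ε ≤ inner ℝ (u : E n) (v : E n)}

/-- `μ` is not concentrated on any closed hemisphere: `∫ ⟨u, v⟩₊ dμ(u) > 0` for all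
`v ∈ S^{n-1}`. -/
def NotConcentrated (μ : Measure (Sph n)) : Prop :=
  ∀ v : Sph n, 0 < ∫ u : Sph n, max (inner ℝ (u : E n) (v : E n)) 0 ∂μ

end DualOrlicz

end

/-!
With `φ' (t) = ψ (t) / t`, minimize `∫ φ(h_K) dμ` among the bodies `K` whose dual volume
`∫ G(ρ_K(u), u) du` does not exceed that of a fixed ball. A body with a small support value `h_K(v)`
has small radial function on a whole cap around `v`, hence large dual volume; a body with a point
far from the origin has large support function on a cap, which has `μ`-measure bounded below
because `μ` is not concentrated on a hemisphere, and `φ` is unbounded because `∫ ψ(s)/s ds`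
diverges. So the competitors lie in a compact class and a minimizer `K` exists.

For continuous `k`, compare `K` with the Wulff shapes of `h_K / (1 - t k)`. The gauge of such a
Wulff shape, the reciprocal of its radial function, is `x ↦ sup_v ⟨x, v⟩ (1 - t k(v)) / h_K(v)`,
a supremum of affine functions of `t`. Its derivative at `t = 0` is read off at the maximizing
`v` wherever that is unique, namely at the directions `u` where the gauge of `K` is
differentiable; these are almost all `u`, and the maximizer is `α_K(u)`. The Lagrange multiplier
rule for the minimization problem then says that `μ` is a constant multiple of the dual Orlicz
curvature measure of `K`.

The `(p,q)`-problem is the case `G(t, u) = t^q ρ_Q(u)^(n-q)`, `ψ(t) = t^p`; as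
`C̃_{p,q}(K, Q, ·)` is homogeneous in `K` of degree `q - p ≠ 0`, a dilation of `K` removes
the constant.
-/

noncomputable section

namespace DualOrlicz

/-! ### Suprema over compact spaces -/

section CompactSpace

variable {X Y : Type*} [TopologicalSpace X] [CompactSpace X]

theorem exists_forall_abs_le {f : X → ℝ} (hf : Continuous f) : ∃ B, ∀ x, |f x| ≤ B :=
  (isCompact_univ.exists_bound_of_continuousOn hf.continuousOn).imp fun _ h x => h x (mem_univ x)

theorem integrable_of_continuous [MeasurableSpace X] [OpensMeasurableSpace X] {ν : Measure X}
    [IsFiniteMeasure ν] {f : X → ℝ} (hf : Continuous f) : Integrable f ν :=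
  hf.integrable_of_hasCompactSupport (.of_compactSpace f)

theorem le_iSup_of_continuous {f : X → ℝ} (hf : Continuous f) (x : X) : f x ≤ ⨆ x, f x :=
  le_ciSup (isCompact_range hf).bddAbove x

theorem exists_eq_iSup_of_continuous [Nonempty X] {f : X → ℝ} (hf : Continuous f) :
    ∃ x, f x = ⨆ x, f x :=
  (isCompact_range hf).sSup_mem (range_nonempty f)

theorem continuous_iSup_of_continuous [TopologicalSpace Y] {F : Y → X → ℝ}
    (hF : Continuous (Function.uncurry F)) : Continuous fun y => ⨆ x, F y x := by
  simpa only [image_univ, sSup_range] using isCompact_univ.continuous_sSup hF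

theorem abs_iSup_sub_iSup_le [Nonempty X] {f g : X → ℝ} (hf : Continuous f) (hg : Continuous g)
    {d : ℝ} (h : ∀ x, |f x - g x| ≤ d) : |(⨆ x, f x) - ⨆ x, g x| ≤ d := by
  refine abs_sub_le_iff.2 ⟨?_, ?_⟩ <;> rw [sub_le_iff_le_add'] <;> refine ciSup_le fun x => ?_
  · linarith [le_iSup_of_continuous hg x, (abs_sub_le_iff.1 (h x)).1]
  · linarith [le_iSup_of_continuous hf x, (abs_sub_le_iff.1 (h x)).2]

theorem tendsto_of_tendsto_comp [TopologicalSpace Y] [T2Space Y] {ι : Type*} {l : Filter ι}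
    {f : X → Y} (hf : Continuous f) {x₀ : X} (hx₀ : ∀ x, f x = f x₀ → x = x₀) {x : ι → X}
    (h : Tendsto (fun i => f (x i)) l (𝓝 (f x₀))) : Tendsto x l (𝓝 x₀) := by
  refine tendsto_nhds_of_unique_mapClusterPt fun y hy => hx₀ y ?_
  have hfy : ClusterPt (f y) (𝓝 (f x₀)) := ClusterPt.mono (hy.tendsto_comp hf.continuousAt) h
  exact eq_of_nhds_neBot hfy

theorem abs_iSup_add_mul_sub_le [Nonempty X] {a b : X → ℝ} (ha : Continuous a) (hb : Continuous b)
    {B : ℝ} (hB : ∀ x, |b x| ≤ B) (t s : ℝ) :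
    |(⨆ x, a x + t * b x) - ⨆ x, a x + s * b x| ≤ B * |t - s| := by
  refine abs_iSup_sub_iSup_le (by fun_prop) (by fun_prop) fun x => ?_
  rw [add_sub_add_left_eq_sub, ← sub_mul, abs_mul, mul_comm]
  gcongr
  exact hB x

-- Danskin's theorem: any maximizers `x t` of `a + t * b` converge to `x₀` as `t → 0`, and comparing
-- the values of `a` and `a + t * b` at `x₀` and `x t` gives two-sided bounds for the increment.
theorem hasDerivAt_iSup_add_mul {a b : X → ℝ} (ha : Continuous a) (hb : Continuous b) {x₀ : X}
    (hx₀ : a x₀ = ⨆ x, a x) (huniq : ∀ x, a x = a x₀ → x = x₀) :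
    HasDerivAt (fun t : ℝ => ⨆ x, a x + t * b x) (b x₀) 0 := by
  have : Nonempty X := ⟨x₀⟩
  obtain ⟨B, hB⟩ := exists_forall_abs_le hb
  have hc (t : ℝ) : Continuous fun x => a x + t * b x := by fun_prop
  choose x hx using fun t => exists_eq_iSup_of_continuous (hc t)
  have hsup : Tendsto (fun t : ℝ => ⨆ x, a x + t * b x) (𝓝 0) (𝓝 (a x₀)) := by
    have hcont : Continuous fun t : ℝ => ⨆ x, a x + t * b x :=
      continuous_iSup_of_continuous (by unfold Function.uncurry; fun_prop)
    simpa [hx₀] using hcont.tendsto 0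
  have hax : Tendsto (fun t => a (x t)) (𝓝 0) (𝓝 (a x₀)) := by
    have htb : Tendsto (fun t : ℝ => t * b (x t)) (𝓝 0) (𝓝 0) :=
      bdd_le_mul_tendsto_zero' B (Eventually.of_forall fun t => hB (x t)) tendsto_id |>.congr
        fun t => mul_comm _ _
    refine ((sub_zero (a x₀)) ▸ hsup.sub htb).congr fun t => ?_
    rw [← hx t, add_sub_cancel_right]
  have hbx : Tendsto (fun t => b (x t)) (𝓝 0) (𝓝 (b x₀)) :=
    (hb.tendsto x₀).comp (tendsto_of_tendsto_comp ha huniq hax)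
  rw [hasDerivAt_iff_isLittleO, Asymptotics.isLittleO_iff]
  intro c hc₀
  filter_upwards [Metric.tendsto_nhds.1 hbx c hc₀] with t ht
  have hlower : a x₀ + t * b x₀ ≤ a (x t) + t * b (x t) :=
    (le_iSup_of_continuous (hc t) x₀).trans_eq (hx t).symm
  have hupper : a (x t) ≤ a x₀ := (le_iSup_of_continuous ha (x t)).trans_eq hx₀.symm
  have hincr : |a (x t) + t * b (x t) - a x₀ - t * b x₀| ≤ |t * (b (x t) - b x₀)| := by
    rw [abs_of_nonneg (by linarith)]
    exact (le_abs_self _).trans' (by linarith)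
  simp only [zero_mul, add_zero, sub_zero, ← hx t, ← hx₀, smul_eq_mul, Real.norm_eq_abs]
  calc _ ≤ |t| * |b (x t) - b x₀| := hincr.trans_eq (abs_mul _ _)
    _ ≤ |t| * c := by gcongr; exact ht.le
    _ = c * |t| := mul_comm _ _

end CompactSpace

theorem isCompact_setOf_lipschitzWith {X Y : Type*} [PseudoMetricSpace X] [CompactSpace X]
    [MetricSpace Y] (C : NNReal) {s : Set Y} (hs : IsCompact s) :
    IsCompact {f : BoundedContinuousFunction X Y | LipschitzWith C f ∧ ∀ x, f x ∈ s} := by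
  refine BoundedContinuousFunction.arzela_ascoli₂ s hs _ ?_ (fun f x hf => hf.2 x)
    (LipschitzWith.uniformEquicontinuous _ C fun f => f.2.1).equicontinuous
  simp only [lipschitzWith_iff_dist_le_mul, ofPred_and, ofPred_forall]
  refine .inter (isClosed_iInter fun x => isClosed_iInter fun y => ?_)
    (isClosed_iInter fun x => hs.isClosed.preimage (continuous_eval_const x))
  exact isClosed_le ((continuous_eval_const x).dist (continuous_eval_const y)) continuous_const

/-! ### Integrals of positive continuous functions -/

/-- The functions in `C⁺(X)`, the domain of Wulff shapes and of the functionals of the variational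
argument. -/
structure IsPosCont {X : Type*} [TopologicalSpace X] (f : X → ℝ) : Prop where
  continuous : Continuous f
  pos : ∀ x, 0 < f x

namespace IsPosCont

variable {X : Type*} [TopologicalSpace X] {f : X → ℝ}

theorem inv (hf : IsPosCont f) : IsPosCont fun x => (f x)⁻¹ :=
  ⟨hf.continuous.inv₀ fun x => (hf.pos x).ne', fun x => inv_pos.2 (hf.pos x)⟩

theorem comp_continuousOn (hf : IsPosCont f) {Γ : ℝ → X → ℝ}
    (hΓ : ContinuousOn (Function.uncurry Γ) (Ioi 0 ×ˢ univ)) : Continuous fun x => Γ (f x) x :=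
  hΓ.comp_continuous (hf.continuous.prodMk continuous_id) fun x => ⟨hf.pos x, mem_univ _⟩

theorem exists_mem_Icc [CompactSpace X] (hf : IsPosCont f) :
    ∃ a b, 0 < a ∧ ∀ x, f x ∈ Icc a b := by
  obtain ⟨A, hA⟩ := exists_forall_abs_le hf.inv.continuous
  obtain ⟨B, hB⟩ := exists_forall_abs_le hf.continuous
  refine ⟨(|A| + 1)⁻¹, B, by positivity, fun x => ⟨?_, (le_abs_self _).trans (hB x)⟩⟩
  rw [inv_le_comm₀ (by positivity) (hf.pos x)]
  linarith [le_abs_self (f x)⁻¹, hA x, le_abs_self A]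

end IsPosCont

theorem continuousOn_uncurry_const {X : Type*} [TopologicalSpace X] {φ : ℝ → ℝ} {s : Set ℝ}
    (hφ : ContinuousOn φ s) :
    ContinuousOn (Function.uncurry fun t (_ : X) => φ t) (s ×ˢ univ) :=
  hφ.comp continuousOn_fst fun _ hp => hp.1

section Integrals

variable {X : Type*} [TopologicalSpace X] [CompactSpace X]

theorem exists_forall_abs_le_of_Icc {Γ : ℝ → X → ℝ}
    (hΓ : ContinuousOn (Function.uncurry Γ) (Ioi 0 ×ˢ univ)) {a : ℝ} (ha : 0 < a) (b : ℝ) :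
    ∃ C, 0 ≤ C ∧ ∀ s ∈ Icc a b, ∀ x, |Γ s x| ≤ C := by
  have hK : IsCompact (Icc a b ×ˢ (univ : Set X)) := isCompact_Icc.prod isCompact_univ
  obtain ⟨C, hC⟩ := hK.exists_bound_of_continuousOn
    (hΓ.mono (prod_mono (fun s hs => ha.trans_le hs.1) subset_rfl))
  exact ⟨max C 0, le_max_right _ _,
    fun s hs x => (hC (s, x) ⟨hs, mem_univ _⟩).trans (le_max_left _ _)⟩

variable [MeasurableSpace X] [OpensMeasurableSpace X] {ν : Measure X} [IsFiniteMeasure ν]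

theorem continuous_integral_comp {Y : Type*} [TopologicalSpace Y] [FirstCountableTopology Y]
    [LocallyCompactSpace Y] {Γ : ℝ → X → ℝ}
    (hΓ : ContinuousOn (Function.uncurry Γ) (Ioi 0 ×ˢ univ)) {D : Y → X → ℝ}
    (hD : IsPosCont (Function.uncurry D)) : Continuous fun y => ∫ x, Γ (D y x) x ∂ν := by
  have hΓD : Continuous (Function.uncurry fun y x => Γ (D y x) x) :=
    hΓ.comp_continuous (hD.continuous.prodMk continuous_snd) fun p => ⟨hD.pos p, mem_univ _⟩
  simpa only [Measure.restrict_univ] using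
    continuous_parametric_integral_of_continuous (μ := ν) hΓD isCompact_univ

theorem hasDerivAt_integral_comp {Γ Γ' : ℝ → X → ℝ}
    (hΓ : ContinuousOn (Function.uncurry Γ) (Ioi 0 ×ˢ univ))
    (hΓ' : ContinuousOn (Function.uncurry Γ') (Ioi 0 ×ˢ univ))
    (hd : ∀ s > 0, ∀ x, HasDerivAt (fun s => Γ s x) (Γ' s x) s)
    {D : ℝ → X → ℝ} {D' : X → ℝ} {M : ℝ} (hDc : ∀ t, Continuous (D t))
    (hL : ∀ t s x, |D t x - D s x| ≤ M * |t - s|) (h0 : ∀ x, 0 < D 0 x)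
    (hm : AEStronglyMeasurable D' ν) (hD' : ∀ᵐ x ∂ν, HasDerivAt (fun t => D t x) (D' x) 0) :
    HasDerivAt (fun t => ∫ x, Γ (D t x) x ∂ν) (∫ x, Γ' (D 0 x) x * D' x ∂ν) 0 := by
  have hD₀ : IsPosCont (D 0) := ⟨hDc 0, h0⟩
  obtain ⟨a, b, ha, hab⟩ := hD₀.exists_mem_Icc
  obtain ⟨C, hC₀, hC⟩ := exists_forall_abs_le_of_Icc hΓ' (half_pos ha) (b + a)
  have hδ : 0 < a / (2 * (|M| + 1)) := by positivity
  have hmem : ∀ t ∈ Metric.ball (0 : ℝ) (a / (2 * (|M| + 1))), ∀ x,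
      D t x ∈ Icc (a / 2) (b + a) := by
    intro t ht x
    have ht' : |t| * (2 * (|M| + 1)) < a := by
      rwa [mem_ball_zero_iff, Real.norm_eq_abs, lt_div_iff₀ (by positivity)] at ht
    have hDt := hL t 0 x
    rw [sub_zero] at hDt
    have := abs_le.1 (show |D t x - D 0 x| ≤ a / 2 by
      nlinarith [abs_nonneg t, le_abs_self M, abs_nonneg M])
    exact ⟨by linarith [this.1, (hab x).1], by linarith [this.2, (hab x).2]⟩
  have hpos : ∀ t ∈ Metric.ball (0 : ℝ) (a / (2 * (|M| + 1))), IsPosCont (D t) := fun t ht =>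
    ⟨hDc t, fun x => (half_pos ha).trans_le (hmem t ht x).1⟩
  refine (hasDerivAt_integral_of_dominated_loc_of_lip (bound := fun _ => C * M)
    (Metric.ball_mem_nhds 0 hδ) ?_ ?_ ?_ ?_ (integrable_const _) ?_).2
  · filter_upwards [Metric.ball_mem_nhds 0 hδ] with t ht
    exact ((hpos t ht).comp_continuousOn hΓ).aestronglyMeasurable
  · exact integrable_of_continuous (hD₀.comp_continuousOn hΓ)
  · exact (hD₀.comp_continuousOn hΓ').aestronglyMeasurable.mul hm
  · refine Eventually.of_forall fun x => LipschitzOnWith.of_dist_le_mul fun t ht s hs => ?_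
    have hM : 0 ≤ M := by simpa using (abs_nonneg _).trans (hL 1 0 x)
    rw [Real.coe_nnabs, abs_of_nonneg (by positivity), mul_assoc]
    refine ((convex_Icc (a / 2) (b + a)).norm_image_sub_le_of_norm_hasDerivWithin_le
      (f := fun s => Γ s x) (f' := fun s => Γ' s x)
      (fun s hs => (hd s ((half_pos ha).trans_le hs.1) x).hasDerivWithinAt)
      (fun s hs => hC s hs x) (hmem s hs x) (hmem t ht x)).trans ?_
    exact mul_le_mul_of_nonneg_left (hL t s x) hC₀
  · filter_upwards [hD'] with x hx
    exact (hd _ (h0 x) x).comp 0 hx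

theorem hasDerivAt_integral_comp_inv {Γ Γ' : ℝ → X → ℝ}
    (hΓ : ContinuousOn (Function.uncurry Γ) (Ioi 0 ×ˢ univ))
    (hΓ' : ContinuousOn (Function.uncurry Γ') (Ioi 0 ×ˢ univ))
    (hd : ∀ s > 0, ∀ x, HasDerivAt (fun s => Γ s x) (Γ' s x) s)
    {D : ℝ → X → ℝ} {κ : X → ℝ} {M : ℝ} (hDc : ∀ t, Continuous (D t))
    (hL : ∀ t s x, |D t x - D s x| ≤ M * |t - s|) (h0 : ∀ x, 0 < D 0 x)
    (hκ : AEStronglyMeasurable κ ν)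
    (hD' : ∀ᵐ x ∂ν, HasDerivAt (fun t => D t x) (-(D 0 x * κ x)) 0) :
    HasDerivAt (fun t => ∫ x, Γ (D t x)⁻¹ x ∂ν)
      (∫ x, (D 0 x)⁻¹ * Γ' (D 0 x)⁻¹ x * κ x ∂ν) 0 := by
  have hinv : ContinuousOn (fun p : ℝ × X => (p.1⁻¹, p.2)) (Ioi 0 ×ˢ univ) :=
    (continuousOn_fst.inv₀ fun p hp => ne_of_gt hp.1).prodMk continuousOn_snd
  have hmaps : MapsTo (fun p : ℝ × X => (p.1⁻¹, p.2)) (Ioi 0 ×ˢ univ) (Ioi 0 ×ˢ univ) :=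
    fun p hp => ⟨inv_pos.2 (mem_Ioi.1 hp.1), mem_univ _⟩
  have hΓ'inv : ContinuousOn (Function.uncurry fun s x => Γ' s⁻¹ x * (-(s ^ 2)⁻¹))
      (Ioi 0 ×ˢ univ) :=
    (hΓ'.comp hinv hmaps).mul <| .neg <|
      (continuousOn_fst.pow 2).inv₀ fun p hp => pow_ne_zero 2 (ne_of_gt hp.1)
  convert hasDerivAt_integral_comp (Γ := fun s x => Γ s⁻¹ x)
    (D' := fun x => -(D 0 x * κ x)) (hΓ.comp hinv hmaps) hΓ'inv
    (fun s hs x => (hd s⁻¹ (inv_pos.2 hs) x).comp s (hasDerivAt_inv hs.ne')) hDc hL h0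
    ((hDc 0).aestronglyMeasurable.mul hκ).neg hD' using 3 with x
  have hx := (h0 x).ne'
  field_simp

end Integrals

/-! ### Linear functionals and Lagrange multipliers -/

section Multiplier

variable {𝕜 M : Type*} [Field 𝕜] [LinearOrder 𝕜] [IsStrictOrderedRing 𝕜] [AddCommGroup M]
  [Module 𝕜 M]

theorem exists_nonpos_eq_smul {A B : M →ₗ[𝕜] 𝕜} (hA : A ≠ 0) (h : ∀ k, A k < 0 → 0 ≤ B k) :
    ∃ l ≤ (0 : 𝕜), B = l • A := by
  obtain ⟨k₀, hk₀⟩ : ∃ k₀, A k₀ < 0 := by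
    obtain ⟨k, hk⟩ := DFunLike.ne_iff.1 hA
    rcases lt_or_gt_of_ne hk with hk | hk
    · exact ⟨k, hk⟩
    · exact ⟨-k, by simpa using hk⟩
  have hker : ∀ k, A k = 0 → B k = 0 := by
    intro k hk
    by_contra hB
    have hline := h ((-(B k₀ + 1) / B k) • k + k₀) (by simpa [hk] using hk₀)
    rw [map_add, map_smul, smul_eq_mul, div_mul_cancel₀ _ hB] at hline
    linarith
  refine ⟨B k₀ / A k₀, div_nonpos_of_nonneg_of_nonpos (h k₀ hk₀) hk₀.le, LinearMap.ext fun k => ?_⟩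
  have hk := hker (k - (A k / A k₀) • k₀) (by
    rw [map_sub, map_smul, smul_eq_mul, div_mul_cancel₀ _ hk₀.ne, sub_self])
  rw [map_sub, map_smul, sub_eq_zero] at hk
  rw [hk, LinearMap.smul_apply, smul_eq_mul, smul_eq_mul]
  field_simp

end Multiplier

theorem eventually_nhdsGT_lt_of_hasDerivAt_neg {f : ℝ → ℝ} {f' x : ℝ} (hf : HasDerivAt f f' x)
    (hf' : f' < 0) : ∀ᶠ t in 𝓝[>] x, f t < f x := by
  have hslope := (hasDerivWithinAt_iff_tendsto_slope' (self_notMem_Ioi (a := x))).1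
    hf.hasDerivWithinAt
  filter_upwards [hslope.eventually_lt_const hf', self_mem_nhdsWithin] with t ht hxt
  rw [slope_def_field, div_neg_iff] at ht
  rcases ht with ht | ht <;> linarith [ht.1, ht.2, mem_Ioi.1 hxt]

/-- The linear functional `k ↦ ∫ w (k ∘ T) dν` on continuous functions, for an integrable weight
`w`. -/
def integralComp {X Y : Type*} [MeasurableSpace X] [TopologicalSpace Y] [CompactSpace Y]
    [MeasurableSpace Y] [OpensMeasurableSpace Y] (ν : Measure X) {w : X → ℝ} (hw : Integrable w ν)
    {T : X → Y} (hT : AEMeasurable T ν) : C(Y, ℝ) →ₗ[ℝ] ℝ :=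
  have hint (k : C(Y, ℝ)) : Integrable (fun x => w x * k (T x)) ν :=
    hw.mul_bdd (k.continuous.measurable.comp_aemeasurable hT).aestronglyMeasurable
      (Eventually.of_forall fun x => k.norm_coe_le_norm (T x))
  { toFun := fun k => ∫ x, w x * k (T x) ∂ν
    map_add' := fun k l => by
      simp only [ContinuousMap.add_apply, mul_add, integral_add (hint k) (hint l)]
    map_smul' := fun c k => by
      simp only [ContinuousMap.smul_apply, smul_eq_mul, mul_left_comm, integral_const_mul,
        RingHom.id_apply] }

theorem measureReal_eq_setIntegral_preimage {X Y : Type*} [MeasurableSpace X] [TopologicalSpace Y]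
    [HasOuterApproxClosed Y] [MeasurableSpace Y] [BorelSpace Y] {μ : Measure Y} {ν : Measure X}
    [IsFiniteMeasure μ] {T : X → Y} (hT : AEMeasurable T ν) {w : X → ℝ} (hw : Integrable w ν)
    (hw0 : ∀ x, 0 ≤ w x)
    (h : ∀ g : BoundedContinuousFunction Y ℝ, ∫ y, g y ∂μ = ∫ x, w x * g (T x) ∂ν)
    {A : Set Y} (hA : MeasurableSet A) : μ.real A = ∫ x in T ⁻¹' A, w x ∂ν := by
  set ν' := (ν.withDensity fun x => ENNReal.ofReal (w x)).map T with hν'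
  have hT' : AEMeasurable T (ν.withDensity fun x => ENNReal.ofReal (w x)) :=
    hT.mono_ac (withDensity_absolutelyContinuous _ _)
  have hfin : IsFiniteMeasure (ν.withDensity fun x => ENNReal.ofReal (w x)) :=
    isFiniteMeasure_withDensity_ofReal hw.2
  have hint : ∀ g : Y → ℝ, AEStronglyMeasurable g ν' →
      ∫ y, g y ∂ν' = ∫ x, w x * g (T x) ∂ν := by
    intro g hg
    rw [hν', integral_map hT' hg, integral_withDensity_eq_integral_toReal_smul₀
      hw.aemeasurable.ennreal_ofReal (Eventually.of_forall fun _ => ENNReal.ofReal_lt_top)]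
    simp only [ENNReal.toReal_ofReal (hw0 _), smul_eq_mul]
  have hμν : μ = ν' := ext_of_forall_integral_eq_of_IsFiniteMeasure fun g => by
    rw [h g, hint g g.continuous.measurable.aestronglyMeasurable]
  have hind : (fun x => w x * A.indicator 1 (T x)) = (T ⁻¹' A).indicator w := by
    ext x
    by_cases hx : T x ∈ A <;> simp [indicator, hx]
  rw [hμν, ← integral_indicator_one hA,
    hint _ (stronglyMeasurable_one.indicator hA).aestronglyMeasurable, hind,
    integral_indicator₀ (hT.nullMeasurableSet_preimage hA)]

/-! ### Integral estimates -/

theorem tendsto_intervalIntegral_atTop {f : ℝ → ℝ} {a : ℝ} (hf : ContinuousOn f (Ici a))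
    (hf0 : ∀ s > a, 0 ≤ f s) (hint : ∫⁻ s in Ioi a, ENNReal.ofReal (f s) = ⊤) :
    Tendsto (fun t => ∫ s in a..t, f s) atTop atTop := by
  have hm : AEMeasurable (fun s => ENNReal.ofReal (f s)) (volume.restrict (Ioi a)) :=
    ((hf.mono Ioi_subset_Ici_self).aemeasurable measurableSet_Ioi).ennreal_ofReal
  have hlim := (aecover_Iic tendsto_id).lintegral_tendsto_of_countably_generated hm
  rw [hint] at hlim
  refine ENNReal.tendsto_ofReal_nhds_top.1 (hlim.congr' ?_)
  filter_upwards [eventually_ge_atTop a] with t ht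
  rw [id, Measure.restrict_restrict measurableSet_Iic, Iic_inter_Ioi,
    intervalIntegral.integral_of_le ht, ofReal_integral_eq_lintegral_ofReal]
  · exact (intervalIntegrable_iff_integrableOn_Ioc_of_le ht).1
      ((hf.mono Icc_subset_Ici_self).intervalIntegrable_of_Icc ht)
  · filter_upwards [ae_restrict_mem measurableSet_Ioc] with s hs using hf0 s hs.1

theorem hasDerivAt_intervalIntegral {f : ℝ → ℝ} {s : Set ℝ} (hs : IsOpen s)
    (hs' : s.OrdConnected) (hf : ContinuousOn f s) {a t : ℝ} (ha : a ∈ s) (ht : t ∈ s) :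
    HasDerivAt (fun t => ∫ x in a..t, f x) (f t) t :=
  intervalIntegral.integral_hasDerivAt_right
    (hf.mono (hs'.uIcc_subset ha ht)).intervalIntegrable
    (hf.stronglyMeasurableAtFilter hs t ht) (hf.continuousAt (hs.mem_nhds ht))

theorem lintegral_Ioi_rpow_eq_top {a : ℝ} (ha : -1 ≤ a) {c : ℝ} (hc : 0 < c) :
    ∫⁻ s in Ioi c, ENNReal.ofReal (s ^ a) = ⊤ := by
  by_contra hne
  have hm : AEStronglyMeasurable (fun s : ℝ => s ^ a) (volume.restrict (Ioi c)) :=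
    (by fun_prop : Measurable fun s : ℝ => s ^ a).aestronglyMeasurable
  have h0 : 0 ≤ᵐ[volume.restrict (Ioi c)] fun s : ℝ => s ^ a := by
    filter_upwards [ae_restrict_mem measurableSet_Ioi] with s hs using
      Real.rpow_nonneg (hc.trans hs).le a
  have hint :=
    (integrableOn_Ioi_rpow_iff hc).1 ((lintegral_ofReal_ne_top_iff_integrable hm h0).1 hne)
  exact hint.not_ge ha

theorem mul_sub_le_integral_sub {X : Type*} [MeasurableSpace X] {μ : Measure X}
    [IsFiniteMeasure μ] {f : X → ℝ} (hf : Integrable f μ) {c d m : ℝ} (hc : ∀ x, c ≤ f x)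
    (hcd : c ≤ d) {A : Set X} (hA : ∀ x ∈ A, d ≤ f x) (hm : m ≤ μ.real A) :
    m * (d - c) ≤ ∫ x, f x ∂μ - μ.real univ * c :=
  calc m * (d - c) ≤ μ.real {x | d - c ≤ f x - c} * (d - c) :=
        mul_le_mul_of_nonneg_right
          (hm.trans (measureReal_mono fun x hx => sub_le_sub_right (hA x hx) c)) (sub_nonneg.2 hcd)
    _ ≤ ∫ x, (f x - c) ∂μ := by
        rw [mul_comm]
        exact mul_meas_ge_le_integral_of_nonneg (Eventually.of_forall fun x => sub_nonneg.2 (hc x))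
          (hf.sub (integrable_const c)) (d - c)
    _ = ∫ x, f x ∂μ - μ.real univ * c := by
        rw [integral_sub hf (integrable_const c), integral_const, smul_eq_mul]

/-! ### Support functions and Wulff shapes -/

open scoped Pointwise

theorem nonempty_sph_of_ne_zero {μ : Measure (Sph n)} (hμ : μ ≠ 0) : Nonempty (Sph n) := by
  by_contra h
  rw [not_nonempty_iff] at h
  exact hμ (Measure.eq_zero_of_isEmpty μ)

theorem dim_ne_zero [Nonempty (Sph n)] : n ≠ 0 := by
  rintro rfl
  obtain ⟨u⟩ := ‹Nonempty (Sph 0)›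
  simpa [Subsingleton.elim (u : E 0) 0] using norm_eq_of_mem_sphere u

theorem inner_sph_self (v : Sph n) : inner ℝ (v : E n) (v : E n) = 1 := by
  rw [real_inner_self_eq_norm_sq, norm_eq_of_mem_sphere, one_pow]

theorem inner_sph_le_norm (x : E n) (v : Sph n) : inner ℝ x (v : E n) ≤ ‖x‖ := by
  simpa using real_inner_le_norm x (v : E n)

theorem exists_eq_norm_smul_sph {x : E n} (hx : x ≠ 0) : ∃ u : Sph n, x = ‖x‖ • (u : E n) :=
  ⟨⟨‖x‖⁻¹ • x, by simp [norm_smul, hx]⟩, by simp [hx]⟩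

instance : IsFiniteMeasure (sphMeasure n) := inferInstanceAs (IsFiniteMeasure volume.toSphere)

instance : (sphMeasure n).IsOpenPosMeasure :=
  inferInstanceAs (Measure.IsOpenPosMeasure volume.toSphere)

theorem ae_sphMeasure_of_ae {P : E n → Prop} (hm : MeasurableSet {x | P x})
    (hP : ∀ᵐ x ∂(volume : Measure (E n)), P x) (hs : ∀ (c : ℝ) (x : E n), 0 < c → P (c • x) → P x) :
    ∀ᵐ u : Sph n ∂(sphMeasure n), P u := by
  have hm' : MeasurableSet {u : Sph n | ¬ P u} := (measurable_subtype_coe hm).compl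
  have hcone : volume (Ioo (0 : ℝ) 1 • (Subtype.val '' {u : Sph n | ¬ P u})) = 0 := by
    refine measure_mono_null ?_ (ae_iff.1 hP)
    rintro _ ⟨c, hc, _, ⟨u, hu, rfl⟩, rfl⟩
    exact fun h => hu (hs c u hc.1 h)
  rw [ae_iff, sphMeasure, Measure.toSphere_apply' _ hm', hcone, mul_zero]

section SupportFunction

variable {K : Set (E n)}

theorem inner_le_suppFun (hK : IsCompact K) (u : E n) {x : E n} (hx : x ∈ K) :
    inner ℝ u x ≤ suppFun K u :=
  le_csSup (hK.image (by fun_prop)).bddAbove (mem_image_of_mem _ hx)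

theorem suppFun_le (hne : K.Nonempty) {u : E n} {c : ℝ} (h : ∀ x ∈ K, inner ℝ u x ≤ c) :
    suppFun K u ≤ c :=
  csSup_le (hne.image _) (forall_mem_image.2 h)

theorem exists_inner_eq_suppFun (hK : IsCompact K) (hne : K.Nonempty) (u : E n) :
    ∃ x ∈ K, inner ℝ u x = suppFun K u :=
  (hK.image (by fun_prop)).sSup_mem (hne.image _)

theorem continuous_suppFun (hK : IsCompact K) : Continuous (suppFun K) :=
  hK.continuous_sSup (f := fun u x => inner ℝ u x) continuous_inner

theorem suppFun_sub_le (hK : IsCompact K) (hne : K.Nonempty) {R : ℝ} (hR : ∀ x ∈ K, ‖x‖ ≤ R)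
    (u v : E n) : suppFun K u - suppFun K v ≤ R * ‖u - v‖ := by
  obtain ⟨x, hx, hxu⟩ := exists_inner_eq_suppFun hK hne u
  calc suppFun K u - suppFun K v ≤ inner ℝ u x - inner ℝ v x := by
        rw [hxu]; gcongr; exact inner_le_suppFun hK v hx
    _ = inner ℝ (u - v) x := (inner_sub_left u v x).symm
    _ ≤ ‖u - v‖ * ‖x‖ := real_inner_le_norm _ _
    _ ≤ ‖u - v‖ * R := by gcongr; exact hR x hx
    _ = R * ‖u - v‖ := mul_comm _ _

theorem suppFun_smul {c : ℝ} (hc : 0 ≤ c) (K : Set (E n)) (u : E n) :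
    suppFun (c • K) u = c * suppFun K u := by
  rw [suppFun, suppFun, ← smul_eq_mul, ← Real.sSup_smul_of_nonneg hc, ← image_smul, ← image_smul,
    image_image, image_image]
  simp only [real_inner_smul_right, smul_eq_mul]

end SupportFunction

/-- The Wulff shape of a function `f` on the sphere. -/
def wulffSet (f : Sph n → ℝ) : Set (E n) := {x | ∀ v : Sph n, inner ℝ x (v : E n) ≤ f v}

section Wulff

variable {f : Sph n → ℝ}

theorem convex_wulffSet (f : Sph n → ℝ) : Convex ℝ (wulffSet f) := by
  simp only [wulffSet, ofPred_forall]
  exact convex_iInter fun v =>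
    convex_halfSpace_le ((innerₗ (E n)).flip (v : E n)).isLinear (f v)

theorem isClosed_wulffSet (f : Sph n → ℝ) : IsClosed (wulffSet f) := by
  simp only [wulffSet, ofPred_forall]
  exact isClosed_iInter fun v => isClosed_le (by fun_prop) continuous_const

theorem norm_le_of_mem_wulffSet {b : ℝ} (hb : 0 ≤ b) (hf : ∀ v, f v ≤ b) {x : E n}
    (hx : x ∈ wulffSet f) : ‖x‖ ≤ b := by
  rcases eq_or_ne x 0 with rfl | hx0
  · simpa using hb
  obtain ⟨u, hu⟩ := exists_eq_norm_smul_sph hx0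
  calc ‖x‖ = inner ℝ (‖x‖ • (u : E n)) u := by
        rw [real_inner_smul_left, inner_sph_self, mul_one]
    _ ≤ b := hu ▸ (hx u).trans (hf u)

theorem ball_subset_wulffSet {a : ℝ} (hf : ∀ v, a ≤ f v) : Metric.ball 0 a ⊆ wulffSet f :=
  fun x hx v => (inner_sph_le_norm x v).trans ((mem_ball_zero_iff.1 hx).le.trans (hf v))

/-- The Wulff shape of a function in `C⁺(S^{n-1})` as a convex body. -/
def wulffBody (hf : IsPosCont f) : ConvexBody (E n) where
  carrier := wulffSet f
  convex' := convex_wulffSet f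
  isCompact' := by
    obtain ⟨B, hB⟩ := exists_forall_abs_le hf.continuous
    refine (isCompact_closedBall (0 : E n) |B|).of_isClosed_subset (isClosed_wulffSet f) fun x hx =>
      mem_closedBall_zero_iff.2 (norm_le_of_mem_wulffSet (abs_nonneg B) (fun v => ?_) hx)
    exact (le_abs_self _).trans ((hB v).trans (le_abs_self B))
  nonempty' := ⟨0, fun v => by simpa using (hf.pos v).le⟩

theorem coe_wulffBody (hf : IsPosCont f) : (wulffBody hf : Set (E n)) = wulffSet f := rfl

theorem isKo_wulffBody (hf : IsPosCont f) : IsKo (wulffBody hf) := by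
  obtain ⟨a, b, ha, hab⟩ := hf.exists_mem_Icc
  exact mem_interior_iff_mem_nhds.2 <| Filter.mem_of_superset (Metric.ball_mem_nhds 0 ha) <|
    ball_subset_wulffSet fun v => (hab v).1

theorem suppFun_wulffSet_le (hf : IsPosCont f) (v : Sph n) : suppFun (wulffSet f) v ≤ f v :=
  suppFun_le (wulffBody hf).nonempty fun x hx => real_inner_comm x (v : E n) ▸ hx v

theorem gauge_wulffSet [Nonempty (Sph n)] (hf : IsPosCont f) (x : E n) :
    gauge (wulffSet f) x = ⨆ v : Sph n, inner ℝ x (v : E n) / f v := by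
  have hc : Continuous fun v : Sph n => inner ℝ x (v : E n) / f v :=
    .div (by fun_prop) hf.continuous fun v => (hf.pos v).ne'
  have hmem {r : ℝ} (hr : 0 < r) :
      x ∈ r • wulffSet f ↔ ⨆ v : Sph n, inner ℝ x (v : E n) / f v ≤ r := by
    rw [mem_smul_set_iff_inv_smul_mem₀ hr.ne', ciSup_le_iff (isCompact_range hc).bddAbove]
    refine forall_congr' fun v => ?_
    rw [real_inner_smul_left, inv_mul_le_iff₀ hr, div_le_iff₀ (hf.pos v)]
  have hnonneg : 0 ≤ ⨆ v : Sph n, inner ℝ x (v : E n) / f v := by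
    rcases eq_or_ne x 0 with rfl | hx
    · simp
    obtain ⟨u, hu⟩ := exists_eq_norm_smul_sph hx
    refine le_trans ?_ (le_iSup_of_continuous hc u)
    rw [hu, real_inner_smul_left, inner_sph_self, mul_one]
    exact div_nonneg (norm_nonneg x) (hf.pos u).le
  refine le_antisymm (le_of_forall_gt_imp_ge_of_dense fun r hr => ?_) ?_
  · exact gauge_le_of_mem (hnonneg.trans hr.le) ((hmem (hnonneg.trans_lt hr)).2 hr.le)
  · refine le_csInf ?_ fun r hr => (hmem hr.1).1 hr.2
    exact (absorbent_nhds_zero (mem_interior_iff_mem_nhds.1 (isKo_wulffBody hf))).gauge_set_nonempty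

theorem wulffSet_suppFun (K : ConvexBody (E n)) :
    wulffSet (fun v : Sph n => suppFun (K : Set (E n)) v) = K := by
  refine Subset.antisymm (fun x hx => ?_) fun x hx v =>
    real_inner_comm x (v : E n) ▸ inner_le_suppFun K.isCompact v hx
  rw [← iInter_halfSpaces_eq K.convex K.isClosed]
  refine mem_iInter.2 fun l => ?_
  obtain ⟨w, rfl⟩ := (InnerProductSpace.toDual ℝ (E n)).surjective l
  rcases eq_or_ne w 0 with rfl | hw
  · obtain ⟨y, hy⟩ := K.nonempty
    exact ⟨y, hy, by simp⟩
  obtain ⟨v, hv⟩ := exists_eq_norm_smul_sph hw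
  obtain ⟨y, hy, hyv⟩ := exists_inner_eq_suppFun K.isCompact K.nonempty v
  refine ⟨y, hy, ?_⟩
  rw [InnerProductSpace.toDual_apply_apply, InnerProductSpace.toDual_apply_apply, hv,
    real_inner_smul_left, real_inner_smul_left, hyv, real_inner_comm]
  gcongr
  exact hx v

end Wulff

/-! ### The gauge and the radial Gauss map -/

namespace IsKo

variable {K : ConvexBody (E n)}

theorem mem_nhds (hK : IsKo K) : (K : Set (E n)) ∈ 𝓝 0 := mem_interior_iff_mem_nhds.1 hK

theorem suppFun_pos (hK : IsKo K) (v : Sph n) : 0 < suppFun K (v : E n) := by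
  obtain ⟨ε, hε, hball⟩ := Metric.mem_nhds_iff.1 hK.mem_nhds
  have hmem : (ε / 2) • (v : E n) ∈ (K : Set (E n)) := hball <| by
    rw [mem_ball_zero_iff, norm_smul, norm_eq_of_mem_sphere, mul_one, Real.norm_of_nonneg] <;>
      linarith
  refine lt_of_lt_of_le ?_ (inner_le_suppFun K.isCompact v hmem)
  rw [real_inner_smul_right, inner_sph_self, mul_one]
  exact half_pos hε

theorem isPosCont_suppFun (hK : IsKo K) : IsPosCont fun v : Sph n => suppFun K (v : E n) :=
  ⟨(continuous_suppFun K.isCompact).comp continuous_subtype_val, hK.suppFun_pos⟩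

theorem gauge_pos (hK : IsKo K) (u : Sph n) : 0 < gauge K (u : E n) :=
  (_root_.gauge_pos (absorbent_nhds_zero hK.mem_nhds) (NormedSpace.isVonNBounded_iff ℝ |>.2
    K.isBounded)).2 (ne_zero_of_mem_unit_sphere u)

theorem isPosCont_gauge (hK : IsKo K) : IsPosCont fun u : Sph n => gauge K (u : E n) :=
  ⟨(continuous_gauge K.convex hK.mem_nhds).comp continuous_subtype_val, hK.gauge_pos⟩

theorem mem_iff_gauge_le_one (hK : IsKo K) {x : E n} : x ∈ (K : Set (E n)) ↔ gauge K x ≤ 1 := by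
  rw [gauge_le_one_iff_mem_closure K.convex hK.mem_nhds, K.isClosed.closure_eq]

theorem radFun_eq_inv_gauge (hK : IsKo K) (u : Sph n) :
    radFun K (u : E n) = (gauge K (u : E n))⁻¹ := by
  have hset : {r : ℝ | 0 < r ∧ r • (u : E n) ∈ (K : Set (E n))} =
      Ioc 0 (gauge K (u : E n))⁻¹ := by
    ext r
    refine and_congr_right fun hr => ?_
    rw [hK.mem_iff_gauge_le_one, gauge_smul_of_nonneg hr.le, smul_eq_mul, ← one_div,
      le_div_iff₀ (hK.gauge_pos u)]
  rw [radFun, hset, csSup_Ioc (inv_pos.2 (hK.gauge_pos u))]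

theorem isPosCont_radFun (hK : IsKo K) : IsPosCont fun u : Sph n => radFun K (u : E n) := by
  simpa only [hK.radFun_eq_inv_gauge] using hK.isPosCont_gauge.inv

theorem gauge_eq_iSup [Nonempty (Sph n)] (hK : IsKo K) (x : E n) :
    gauge K x = ⨆ v : Sph n, inner ℝ x (v : E n) / suppFun K (v : E n) := by
  rw [← gauge_wulffSet hK.isPosCont_suppFun, wulffSet_suppFun]

theorem continuous_inner_div_suppFun (hK : IsKo K) (x : E n) :
    Continuous fun v : Sph n => inner ℝ x (v : E n) / suppFun K (v : E n) :=
  .div (by fun_prop) hK.isPosCont_suppFun.continuous fun v => (hK.suppFun_pos v).ne'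

theorem inner_le_gauge_mul_suppFun (hK : IsKo K) (x : E n) (v : Sph n) :
    inner ℝ x (v : E n) ≤ gauge K x * suppFun K (v : E n) := by
  have : Nonempty (Sph n) := ⟨v⟩
  rw [← div_le_iff₀ (hK.suppFun_pos v), hK.gauge_eq_iSup]
  exact le_iSup_of_continuous (hK.continuous_inner_div_suppFun x) v

theorem mem_radGaussSet_singleton (hK : IsKo K) {u v : Sph n} :
    v ∈ radGaussSet K {u} ↔
      inner ℝ (u : E n) (v : E n) = gauge K (u : E n) * suppFun K (v : E n) := by
  simp only [radGaussSet, normalSet, image_singleton, mem_singleton_iff, exists_eq_left,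
    suppPlane, mem_ofPred_eq, real_inner_smul_left, hK.radFun_eq_inv_gauge]
  exact inv_mul_eq_iff_eq_mul₀ (hK.gauge_pos u).ne'

theorem radGaussSet_singleton_nonempty (hK : IsKo K) (u : Sph n) :
    (radGaussSet K {u}).Nonempty := by
  have : Nonempty (Sph n) := ⟨u⟩
  obtain ⟨v, hv⟩ := exists_eq_iSup_of_continuous (hK.continuous_inner_div_suppFun u)
  rw [← hK.gauge_eq_iSup, div_eq_iff (hK.suppFun_pos v).ne'] at hv
  exact ⟨v, hK.mem_radGaussSet_singleton.2 hv⟩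

-- `x ↦ gauge K x * h_K(v) - ⟪x, v⟫` is nonnegative and vanishes at `u` if `v` is normal there.
theorem eq_suppFun_smul_gradient_gauge (hK : IsKo K) {u v : Sph n}
    (hu : DifferentiableAt ℝ (gauge K) (u : E n)) (hv : v ∈ radGaussSet K {u}) :
    (v : E n) = suppFun K (v : E n) • gradient (gauge K) (u : E n) := by
  have hmin : IsLocalMin (fun x : E n => gauge K x * suppFun K (v : E n) -
      innerSL ℝ (v : E n) x) u := by
    refine Eventually.of_forall fun x => ?_
    have hx := hK.inner_le_gauge_mul_suppFun x v
    have huv := hK.mem_radGaussSet_singleton.1 hv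
    simp only [innerSL_apply_apply, real_inner_comm _ (v : E n)]
    rw [← huv]
    linarith
  have hcrit := sub_eq_zero.1 <| hmin.hasFDerivAt_eq_zero <|
    (hu.hasFDerivAt.mul_const (suppFun K (v : E n))).sub (innerSL ℝ (v : E n)).hasFDerivAt
  rw [gradient, ← map_smul, hcrit]
  exact ((InnerProductSpace.toDual ℝ (E n)).symm_apply_apply (v : E n)).symm

theorem eq_normalize_gradient_gauge (hK : IsKo K) {u v : Sph n}
    (hu : DifferentiableAt ℝ (gauge K) (u : E n)) (hv : v ∈ radGaussSet K {u}) :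
    (v : E n) = ‖gradient (gauge K) (u : E n)‖⁻¹ • gradient (gauge K) (u : E n) := by
  have hgrad := hK.eq_suppFun_smul_gradient_gauge hu hv
  have hnorm : 1 = suppFun K (v : E n) * ‖gradient (gauge K) (u : E n)‖ := by
    have := congrArg norm hgrad
    rwa [norm_eq_of_mem_sphere, norm_smul, Real.norm_of_nonneg (hK.suppFun_pos v).le] at this
  rwa [eq_inv_of_mul_eq_one_left hnorm.symm] at hgrad

theorem radGaussSet_singleton (hK : IsKo K) {u : Sph n}
    (hu : DifferentiableAt ℝ (gauge K) (u : E n)) :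
    radGaussSet K {u} = {radGauss K u} := by
  have hex : ∃ v, radGaussSet K {u} = {v} := by
    obtain ⟨v, hv⟩ := hK.radGaussSet_singleton_nonempty u
    refine ⟨v, eq_singleton_iff_unique_mem.2 ⟨hv, fun w hw => Subtype.ext ?_⟩⟩
    rw [hK.eq_normalize_gradient_gauge hu hw, hK.eq_normalize_gradient_gauge hu hv]
  rw [radGauss, dif_pos hex]
  exact hex.choose_spec

theorem ae_differentiableAt_gauge (hK : IsKo K) :
    ∀ᵐ u : Sph n ∂(sphMeasure n), DifferentiableAt ℝ (gauge K) (u : E n) := by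
  obtain ⟨C, hC⟩ := K.convex.lipschitz_gauge hK.mem_nhds
  refine ae_sphMeasure_of_ae (measurableSet_of_differentiableAt ℝ _) hC.ae_differentiableAt
    fun c x hc h => ?_
  have hscaled : DifferentiableAt ℝ (fun y : E n => c⁻¹ * gauge K (c • y)) x :=
    (DifferentiableAt.comp x h (differentiableAt_id.const_smul c)).const_mul _
  refine hscaled.congr_of_eventuallyEq (Eventually.of_forall fun y => ?_)
  simp only [gauge_smul_of_nonneg hc.le, smul_eq_mul, inv_mul_cancel_left₀ hc.ne']

theorem aemeasurable_radGauss (hK : IsKo K) : AEMeasurable (radGauss K) (sphMeasure n) := by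
  have hemb : MeasurableEmbedding (Subtype.val : Sph n → E n) :=
    MeasurableEmbedding.subtype_coe Metric.isClosed_sphere.measurableSet
  rw [← hemb.aemeasurable_comp_iff]
  have hg : Measurable fun u : Sph n => gradient (gauge K) (u : E n) :=
    ((InnerProductSpace.toDual ℝ (E n)).symm.continuous.measurable.comp
      (measurable_fderiv ℝ _)).comp measurable_subtype_coe
  refine ⟨fun u => ‖gradient (gauge K) (u : E n)‖⁻¹ • gradient (gauge K) (u : E n),
    hg.norm.inv.smul hg, ?_⟩
  filter_upwards [hK.ae_differentiableAt_gauge] with u hu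
  exact hK.eq_normalize_gradient_gauge hu (hK.radGaussSet_singleton hu ▸ mem_singleton _)

theorem mem_revRadGaussSet (hK : IsKo K) {A : Set (Sph n)} {u : Sph n} :
    u ∈ revRadGaussSet K A ↔ (radGaussSet K {u} ∩ A).Nonempty := by
  have hfrontier {x : E n} : x ∈ frontier (K : Set (E n)) ↔ gauge K x = 1 :=
    (gauge_eq_one_iff_mem_frontier K.convex hK.mem_nhds).symm
  have hrad := hK.isPosCont_radFun.pos u
  simp only [radGaussSet, normalSet, image_singleton, mem_singleton_iff, exists_eq_left]
  constructor
  · rintro ⟨v, hvA, x, ⟨hxK, hxv⟩, hux⟩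
    have hx0 : x ≠ 0 := by
      rintro rfl
      simp [hfrontier] at hxK
    have hx : x = ‖x‖ • (u : E n) := by rw [hux, smul_inv_smul₀ (norm_ne_zero_iff.2 hx0)]
    have hnorm : ‖x‖ = radFun K (u : E n) := by
      rw [hfrontier, hx, gauge_smul_of_nonneg (norm_nonneg x), smul_eq_mul] at hxK
      rw [hK.radFun_eq_inv_gauge, eq_inv_of_mul_eq_one_left hxK]
    exact ⟨v, hnorm ▸ hx ▸ hxv, hvA⟩
  · rintro ⟨v, hv, hvA⟩
    refine ⟨v, hvA, _, ⟨hfrontier.2 ?_, hv⟩, ?_⟩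
    · rw [gauge_smul_of_nonneg hrad.le, hK.radFun_eq_inv_gauge, smul_eq_mul,
        inv_mul_cancel₀ (hK.gauge_pos u).ne']
    · rw [norm_smul, norm_eq_of_mem_sphere, mul_one, Real.norm_of_nonneg hrad.le,
        inv_smul_smul₀ hrad.ne']

theorem revRadGaussSet_ae_eq (hK : IsKo K) (A : Set (Sph n)) :
    revRadGaussSet K A =ᵐ[sphMeasure n] radGauss K ⁻¹' A := by
  filter_upwards [hK.ae_differentiableAt_gauge] with u hu
  refine propext (hK.mem_revRadGaussSet.trans ?_)
  rw [hK.radGaussSet_singleton hu, singleton_inter_nonempty]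
  rfl

end IsKo

/-! ### A priori bounds -/

/-- The dual volume `∫ G(ρ_K(u), u) du` of `K` with respect to `G`. -/
def dualVol (G : ℝ → Sph n → ℝ) (K : Set (E n)) : ℝ :=
  ∫ u, G (radFun K (u : E n)) u ∂(sphMeasure n)

theorem measurableSet_cap (ε : ℝ) (v : Sph n) : MeasurableSet (cap ε v) :=
  (isClosed_le continuous_const (by fun_prop)).measurableSet

theorem IsKo.radFun_mul_inner_le {K : ConvexBody (E n)} (hK : IsKo K) (u v : Sph n) :
    radFun K (u : E n) * inner ℝ (u : E n) (v : E n) ≤ suppFun K (v : E n) := by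
  rw [hK.radFun_eq_inv_gauge, inv_mul_le_iff₀ (hK.gauge_pos u)]
  exact hK.inner_le_gauge_mul_suppFun u v

theorem half_le_inner_of_mem_cap {ε : ℝ} {u v v₀ : Sph n} (hu : u ∈ cap ε v₀)
    (hv : dist v v₀ ≤ ε / 2) : ε / 2 ≤ inner ℝ (u : E n) (v : E n) := by
  have hdiff : inner ℝ ((v₀ : E n) - (v : E n)) (u : E n) ≤ ε / 2 := by
    refine (inner_sph_le_norm _ u).trans ?_
    rwa [← dist_eq_norm, dist_comm]
  rw [inner_sub_left, real_inner_comm, real_inner_comm (u : E n)] at hdiff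
  linarith [show ε ≤ inner ℝ (u : E n) (v₀ : E n) from hu]

theorem exists_le_measureReal_cap {μ : Measure (Sph n)} [IsFiniteMeasure μ]
    (hμ : NotConcentrated μ) : ∃ δ > 0, ∀ v : Sph n, δ ≤ μ.real (cap δ v) := by
  have hc : Continuous fun v : Sph n => ∫ u : Sph n, max (inner ℝ (u : E n) (v : E n)) 0 ∂μ := by
    simpa only [Measure.restrict_univ] using continuous_parametric_integral_of_continuous
      (f := fun v u : Sph n => max (inner ℝ (u : E n) (v : E n)) 0) (by fun_prop) isCompact_univ
  obtain ⟨m, _, hm, hmv⟩ := IsPosCont.exists_mem_Icc ⟨hc, hμ⟩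
  have hδ : 0 < m / (μ.real univ + 1) := by positivity
  refine ⟨m / (μ.real univ + 1), hδ, fun v => ?_⟩
  set δ := m / (μ.real univ + 1)
  have hind : Integrable ((cap δ v).indicator fun _ => (1 : ℝ)) μ :=
    (integrable_const 1).indicator (measurableSet_cap δ v)
  have hle : m ≤ δ * μ.real univ + μ.real (cap δ v) :=
    calc m ≤ ∫ u : Sph n, max (inner ℝ (u : E n) (v : E n)) 0 ∂μ := (hmv v).1
      _ ≤ ∫ u, (δ + (cap δ v).indicator (fun _ => 1) u) ∂μ := by
        refine integral_mono (integrable_of_continuous (by fun_prop))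
          ((integrable_const δ).add hind) fun u => ?_
        have hu : inner ℝ (u : E n) (v : E n) ≤ 1 :=
          (inner_sph_le_norm _ v).trans (norm_eq_of_mem_sphere u).le
        by_cases huv : u ∈ cap δ v
        · simpa only [indicator_of_mem huv] using max_le (by linarith) (by linarith)
        · simpa only [indicator_of_notMem huv, add_zero] using max_le (not_le.1 huv).le hδ.le
      _ = δ * μ.real univ + μ.real (cap δ v) := by
        rw [integral_add (integrable_const δ) hind, integral_indicator_const 1
          (measurableSet_cap δ v), integral_const, smul_eq_mul, smul_eq_mul, mul_one, mul_comm]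
  have hm' : δ * (μ.real univ + 1) = m := div_mul_cancel₀ m (by positivity)
  linarith

theorem setIntegral_sub_le_dualVol {G : ℝ → Sph n → ℝ}
    (hG : ContinuousOn (Function.uncurry G) (Ioi 0 ×ˢ univ))
    (hanti : ∀ u, AntitoneOn (fun t => G t u) (Ioi 0))
    (hinf : Tendsto (fun t => ∫ u, G t u ∂(sphMeasure n)) atTop (𝓝 0)) {K : ConvexBody (E n)}
    (hK : IsKo K) {A : Set (Sph n)} (hA : MeasurableSet A) {s : ℝ} (hs : 0 < s)
    (hsA : ∀ u ∈ A, radFun K (u : E n) ≤ s) :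
    ∫ u in A, G s u ∂(sphMeasure n) - ∫ u in A, G 1 u ∂(sphMeasure n) ≤ dualVol G K := by
  have hint {t : ℝ} (ht : 0 < t) : Integrable (G t) (sphMeasure n) :=
    integrable_of_continuous <|
      IsPosCont.comp_continuousOn (f := fun _ => t) ⟨continuous_const, fun _ => ht⟩ hG
  have hρ := hK.isPosCont_radFun
  have hdiff : Integrable (A.indicator fun u => G s u - G 1 u) (sphMeasure n) :=
    ((hint hs).sub (hint one_pos)).indicator hA
  obtain ⟨B, hB⟩ := exists_forall_abs_le hρ.continuous
  rw [← integral_sub (hint hs).integrableOn (hint one_pos).integrableOn, ← integral_indicator hA]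
  have hlim := hinf.const_add (∫ u, A.indicator (fun u => G s u - G 1 u) u ∂(sphMeasure n))
  rw [add_zero] at hlim
  refine le_of_tendsto hlim ?_
  filter_upwards [eventually_ge_atTop 1, eventually_ge_atTop B] with t ht htB
  have ht0 : 0 < t := one_pos.trans_le ht
  rw [← integral_add hdiff (hint ht0)]
  refine integral_mono (hdiff.add (hint ht0))
    (integrable_of_continuous (hρ.comp_continuousOn hG)) fun u => ?_
  by_cases hu : u ∈ A
  · have hs' := hanti u (hρ.pos u) hs (hsA u hu)
    have ht' := hanti u (mem_Ioi.2 one_pos) ht0 ht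
    simp only [indicator_of_mem hu]
    linarith
  · simpa only [indicator_of_notMem hu, zero_add] using
      hanti u (hρ.pos u) ht0 ((le_abs_self _).trans ((hB u).trans htB))

theorem exists_le_suppFun_of_dualVol_le {G : ℝ → Sph n → ℝ}
    (hG : ContinuousOn (Function.uncurry G) (Ioi 0 ×ˢ univ))
    (hanti : ∀ u, AntitoneOn (fun t => G t u) (Ioi 0))
    (hinf : Tendsto (fun t => ∫ u, G t u ∂(sphMeasure n)) atTop (𝓝 0)) {ε : ℝ} (hε : 0 < ε)
    (hcap : ∀ v, Tendsto (fun t => ∫ u in cap ε v, G t u ∂(sphMeasure n)) (𝓝[>] 0) atTop) (c : ℝ) :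
    ∃ a > 0, ∀ K : ConvexBody (E n), IsKo K → dualVol G K ≤ c →
      ∀ v : Sph n, a ≤ suppFun K (v : E n) := by
  suffices h : ∀ᶠ a in 𝓝 (0 : ℝ), ∀ v ∈ (univ : Set (Sph n)), 0 < a →
      ∀ K : ConvexBody (E n), IsKo K → dualVol G K ≤ c → a ≤ suppFun K (v : E n) by
    obtain ⟨a, ha, ha0⟩ := ((h.filter_mono nhdsWithin_le_nhds).and self_mem_nhdsWithin :
      ∀ᶠ a in 𝓝[>] (0 : ℝ), _).exists
    exact ⟨a, ha0, fun K hK hKc v => ha v (mem_univ v) ha0 K hK hKc⟩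
  refine isCompact_univ.eventually_forall_of_forall_eventually fun v₀ _ => ?_
  have hscale : Tendsto (fun a : ℝ => a / (ε / 2)) (𝓝[>] 0) (𝓝[>] 0) := by
    refine tendsto_nhdsWithin_iff.2 ⟨tendsto_nhdsWithin_of_tendsto_nhds ?_, ?_⟩
    · simpa using (continuous_id.div_const (ε / 2)).tendsto (0 : ℝ)
    · filter_upwards [self_mem_nhdsWithin] with a ha using div_pos ha (half_pos hε)
  have hlarge := eventually_nhdsWithin_iff.1 <| hscale.eventually <|
    (hcap v₀).eventually_gt_atTop (c + ∫ u in cap ε v₀, G 1 u ∂(sphMeasure n))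
  filter_upwards [hlarge.prod_nhds (Metric.closedBall_mem_nhds v₀ (half_pos hε))]
    with ⟨a, v⟩ ⟨hac, hv⟩ ha K hK hKc
  by_contra! hlt
  have hρ : ∀ u ∈ cap ε v₀, radFun K (u : E n) ≤ a / (ε / 2) := fun u hu => by
    rw [le_div_iff₀ (half_pos hε)]
    calc radFun K (u : E n) * (ε / 2) ≤ radFun K (u : E n) * inner ℝ (u : E n) (v : E n) :=
          mul_le_mul_of_nonneg_left (half_le_inner_of_mem_cap hu hv) (hK.isPosCont_radFun.pos u).le
      _ ≤ suppFun K (v : E n) := hK.radFun_mul_inner_le u v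
      _ ≤ a := hlt.le
  have hlow := setIntegral_sub_le_dualVol hG hanti hinf hK (measurableSet_cap ε v₀)
    (div_pos ha (half_pos hε)) hρ
  linarith [hac ha]

theorem exists_norm_le_of_integral_le {μ : Measure (Sph n)} [IsFiniteMeasure μ]
    (hμ : NotConcentrated μ) {φ : ℝ → ℝ} (hφ : ContinuousOn φ (Ioi 0))
    (hmono : MonotoneOn φ (Ioi 0)) (htop : Tendsto φ atTop atTop) {a : ℝ} (ha : 0 < a) (b : ℝ) :
    ∃ R, ∀ K : ConvexBody (E n), IsKo K → (∀ v : Sph n, a ≤ suppFun K (v : E n)) →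
      ∫ v : Sph n, φ (suppFun K (v : E n)) ∂μ ≤ b → ∀ x ∈ (K : Set (E n)), ‖x‖ ≤ R := by
  obtain ⟨δ, hδ, hcap⟩ := exists_le_measureReal_cap hμ
  have hscale : Tendsto (fun r : ℝ => δ * r) atTop atTop := tendsto_id.const_mul_atTop hδ
  obtain ⟨R, hR⟩ := eventually_atTop.1 <| (hscale.eventually_ge_atTop a).and <|
    hscale.eventually (htop.eventually_gt_atTop (φ a + (b - μ.real univ * φ a) / δ))
  refine ⟨R, fun K hK haK hKb x hx => ?_⟩
  by_contra! hlt
  obtain ⟨har, hφr⟩ := hR ‖x‖ hlt.le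
  have hr : 0 < δ * ‖x‖ := ha.trans_le har
  obtain ⟨u, hu⟩ := exists_eq_norm_smul_sph (norm_pos_iff.1 (pos_of_mul_pos_right hr hδ.le))
  have hφcap : ∀ v ∈ cap δ u, φ (δ * ‖x‖) ≤ φ (suppFun K (v : E n)) := fun v hv => by
    refine hmono hr (hK.suppFun_pos v) ?_
    calc δ * ‖x‖ ≤ inner ℝ (v : E n) (u : E n) * ‖x‖ :=
          mul_le_mul_of_nonneg_right hv (norm_nonneg x)
      _ = inner ℝ (v : E n) x := by conv_rhs => rw [hu, real_inner_smul_right, mul_comm]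
      _ ≤ suppFun K (v : E n) := inner_le_suppFun K.isCompact v hx
  have hint : Integrable (fun v : Sph n => φ (suppFun K (v : E n))) μ :=
    integrable_of_continuous (hφ.comp_continuous hK.isPosCont_suppFun.continuous hK.suppFun_pos)
  have hmarkov := mul_sub_le_integral_sub hint
    (fun v => hmono ha (hK.suppFun_pos v) (haK v)) (hmono ha hr har) hφcap (hcap u)
  have hle : φ (δ * ‖x‖) - φ a ≤ (b - μ.real univ * φ a) / δ := by
    rw [le_div_iff₀ hδ, mul_comm]
    linarith
  linarith

/-! ### Existence of minimizers -/

theorem isPosCont_radFun_wulffSet [Nonempty (Sph n)] {Y : Type*} [TopologicalSpace Y]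
    {F : Y → Sph n → ℝ} (hF : IsPosCont (Function.uncurry F)) :
    IsPosCont (Function.uncurry fun y (u : Sph n) => radFun (wulffSet (F y)) (u : E n)) := by
  have hFy (y : Y) : IsPosCont (F y) :=
    ⟨hF.continuous.comp (by fun_prop : Continuous fun v : Sph n => (y, v)), fun v => hF.pos (y, v)⟩
  have hrad (p : Y × Sph n) : radFun (wulffSet (F p.1)) (p.2 : E n) =
      (⨆ v : Sph n, inner ℝ (p.2 : E n) (v : E n) / F p.1 v)⁻¹ := by
    rw [← gauge_wulffSet (hFy p.1), ← coe_wulffBody (hFy p.1),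
      (isKo_wulffBody (hFy p.1)).radFun_eq_inv_gauge]
  have hpos (p : Y × Sph n) : 0 < radFun (wulffSet (F p.1)) (p.2 : E n) :=
    (isKo_wulffBody (hFy p.1)).isPosCont_radFun.pos p.2
  refine ⟨?_, hpos⟩
  simp only [Function.uncurry_def, hrad] at hpos ⊢
  have hquot : Continuous fun q : (Y × Sph n) × Sph n =>
      inner ℝ (q.1.2 : E n) (q.2 : E n) / F q.1.1 q.2 :=
    .div (by fun_prop) (hF.continuous.comp (f := fun q : (Y × Sph n) × Sph n => (q.1.1, q.2))
      (by fun_prop)) fun q => (hF.pos (q.1.1, q.2)).ne'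
  exact (continuous_iSup_of_continuous hquot).inv₀ fun p => (inv_pos.1 (hpos p)).ne'

theorem integral_suppFun_wulffBody_le {μ : Measure (Sph n)} [IsFiniteMeasure μ] {φ : ℝ → ℝ}
    (hφ : ContinuousOn φ (Ioi 0)) (hmono : MonotoneOn φ (Ioi 0)) {f : Sph n → ℝ}
    (hf : IsPosCont f) :
    ∫ v : Sph n, φ (suppFun (wulffBody hf) (v : E n)) ∂μ ≤ ∫ v, φ (f v) ∂μ := by
  have hh := (isKo_wulffBody hf).isPosCont_suppFun
  exact integral_mono (integrable_of_continuous (hφ.comp_continuous hh.continuous hh.pos))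
    (integrable_of_continuous (hφ.comp_continuous hf.continuous hf.pos)) fun v =>
      hmono (hh.pos v) (hf.pos v) (suppFun_wulffSet_le hf v)

/-- The convex bodies whose support functions take values in `[a, R]` and are `R`-Lipschitz,
represented by functions on the sphere which need not be support functions: passing to Wulff shapes
makes up for the difference and saves the proof that limits of support functions are support
functions. -/
abbrev LipschitzClass (n : ℕ) (a : ℝ) (R : NNReal) : Type :=
  {f : BoundedContinuousFunction (Sph n) ℝ // LipschitzWith R f ∧ ∀ v, f v ∈ Icc a (R : ℝ)}

instance (a : ℝ) (R : NNReal) : CompactSpace (LipschitzClass n a R) :=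
  isCompact_iff_compactSpace.1 (isCompact_setOf_lipschitzWith R isCompact_Icc)

theorem isPosCont_lipschitzClass {a : ℝ} (ha : 0 < a) (R : NNReal) :
    IsPosCont (Function.uncurry fun (f : LipschitzClass n a R) (v : Sph n) => f.1 v) := by
  refine ⟨?_, fun p => ha.trans_le (p.1.2.2 p.2).1⟩
  exact (continuous_subtype_val.comp continuous_fst).eval continuous_snd

theorem IsKo.exists_lipschitzClass {K : ConvexBody (E n)} (hK : IsKo K) {a : ℝ} {R : NNReal}
    (ha : ∀ v : Sph n, a ≤ suppFun K (v : E n)) (hR : ∀ x ∈ (K : Set (E n)), ‖x‖ ≤ R) :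
    ∃ f : LipschitzClass n a R, (f.1 : Sph n → ℝ) = fun v : Sph n => suppFun K (v : E n) := by
  refine ⟨⟨.mkOfCompact ⟨_, hK.isPosCont_suppFun.continuous⟩, ?_, fun v => ⟨ha v, ?_⟩⟩, rfl⟩
  · refine LipschitzWith.of_le_add_mul R fun u v => sub_le_iff_le_add'.1 ?_
    rw [Subtype.dist_eq, dist_eq_norm]
    exact suppFun_sub_le K.isCompact K.nonempty hR u v
  · refine suppFun_le K.nonempty fun x hx => ?_
    rw [real_inner_comm]
    exact (inner_sph_le_norm x v).trans (hR x hx)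

/-- The minimization problem solved by `K`: least Orlicz mean `∫ φ(h_L) dμ` among the convex bodies
`L` whose dual volume with respect to `G` is at most that of `K`. -/
structure IsMinimizer (G : ℝ → Sph n → ℝ) (φ : ℝ → ℝ) (μ : Measure (Sph n))
    (K : ConvexBody (E n)) : Prop where
  isKo : IsKo K
  integral_le : ∀ L : ConvexBody (E n), IsKo L → dualVol G L ≤ dualVol G K →
    ∫ v : Sph n, φ (suppFun K (v : E n)) ∂μ ≤ ∫ v : Sph n, φ (suppFun L (v : E n)) ∂μ

theorem exists_isMinimizer [Nonempty (Sph n)] {μ : Measure (Sph n)} [IsFiniteMeasure μ]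
    (hμ : NotConcentrated μ) {G : ℝ → Sph n → ℝ}
    (hG : ContinuousOn (Function.uncurry G) (Ioi 0 ×ˢ univ))
    (hanti : ∀ u, AntitoneOn (fun t => G t u) (Ioi 0))
    (hinf : Tendsto (fun t => ∫ u, G t u ∂(sphMeasure n)) atTop (𝓝 0)) {ε : ℝ} (hε : 0 < ε)
    (hcap : ∀ v, Tendsto (fun t => ∫ u in cap ε v, G t u ∂(sphMeasure n)) (𝓝[>] 0) atTop)
    {φ : ℝ → ℝ} (hφ : ContinuousOn φ (Ioi 0)) (hmono : MonotoneOn φ (Ioi 0))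
    (htop : Tendsto φ atTop atTop) :
    ∃ K : ConvexBody (E n), IsMinimizer G φ μ K := by
  obtain ⟨B, hB⟩ : ∃ B : ConvexBody (E n), IsKo B :=
    ⟨_, isKo_wulffBody (f := fun _ => 1) ⟨continuous_const, fun _ => one_pos⟩⟩
  set b := ∫ v : Sph n, φ (suppFun B (v : E n)) ∂μ
  obtain ⟨a, ha, hlow⟩ := exists_le_suppFun_of_dualVol_le hG hanti hinf hε hcap (dualVol G B)
  obtain ⟨R, hup⟩ := exists_norm_le_of_integral_le hμ hφ hmono htop ha b
  have hpos (f : LipschitzClass n a R.toNNReal) : IsPosCont f.1 :=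
    ⟨f.1.continuous, fun v => (isPosCont_lipschitzClass ha _).pos (f, v)⟩
  have hmem (L : ConvexBody (E n)) (hL : IsKo L) (hLB : dualVol G L ≤ dualVol G B)
      (hLb : ∫ v : Sph n, φ (suppFun L (v : E n)) ∂μ ≤ b) :
      ∃ f : LipschitzClass n a R.toNNReal, (f.1 : Sph n → ℝ) =
        fun v : Sph n => suppFun L (v : E n) :=
    hL.exists_lipschitzClass (hlow L hL hLB) fun x hx =>
      (hup L hL (hlow L hL hLB) hLb x hx).trans (Real.le_coe_toNNReal R)
  have hV : Continuous fun f : LipschitzClass n a R.toNNReal => dualVol G (wulffSet f.1) :=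
    continuous_integral_comp hG (isPosCont_radFun_wulffSet (isPosCont_lipschitzClass ha _))
  have hΦ : Continuous fun f : LipschitzClass n a R.toNNReal => ∫ v, φ (f.1 v) ∂μ :=
    continuous_integral_comp (continuousOn_uncurry_const hφ) (isPosCont_lipschitzClass ha _)
  obtain ⟨fB, hfB⟩ := hmem B hB le_rfl le_rfl
  obtain ⟨f, hf, hmin⟩ := (isClosed_le hV continuous_const).isCompact.exists_isMinOn
    (s := {f | dualVol G (wulffSet f.1) ≤ dualVol G B})
    ⟨fB, by rw [mem_ofPred_eq, hfB, wulffSet_suppFun]⟩ hΦ.continuousOn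
  have hmin' (L : ConvexBody (E n)) (hL : IsKo L) (hLB : dualVol G L ≤ dualVol G B)
      (hLb : ∫ v : Sph n, φ (suppFun L (v : E n)) ∂μ ≤ b) :
      ∫ v, φ (f.1 v) ∂μ ≤ ∫ v : Sph n, φ (suppFun L (v : E n)) ∂μ := by
    obtain ⟨g, hg⟩ := hmem L hL hLB hLb
    simpa only [mem_ofPred_eq, hg] using
      hmin (a := g) (by rwa [mem_ofPred_eq, hg, wulffSet_suppFun])
  refine ⟨wulffBody (hpos f), isKo_wulffBody _, fun L hL hLK => ?_⟩
  refine (integral_suppFun_wulffBody_le hφ hmono (hpos f)).trans ?_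
  rcases le_total (∫ v : Sph n, φ (suppFun L (v : E n)) ∂μ) b with hLb | hLb
  · exact hmin' L hL (hLK.trans hf) hLb
  · exact (hmin' B hB le_rfl le_rfl).trans hLb

/-! ### The Euler–Lagrange equation -/

/-- The variation of `h` whose logarithmic derivative at `t = 0` is `k`, parametrized so that
`1 / h` varies affinely: the gauge of the Wulff shape is then a supremum of affine functions of
`t`. -/
def reciprocalVariation {X : Type*} (h k : X → ℝ) (t : ℝ) (x : X) : ℝ := h x / (1 - t * k x)

section ReciprocalVariation

variable {X : Type*} [TopologicalSpace X] [CompactSpace X] {h k : X → ℝ}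

theorem reciprocalVariation_zero {X : Type*} (h k : X → ℝ) : reciprocalVariation h k 0 = h := by
  ext x
  simp [reciprocalVariation]

theorem eventually_isPosCont_reciprocalVariation (hh : IsPosCont h) (hk : Continuous k) :
    ∀ᶠ t in 𝓝 0, IsPosCont (reciprocalVariation h k t) := by
  obtain ⟨C, hC⟩ := exists_forall_abs_le hk
  have hlim : Tendsto (fun t : ℝ => |t| * |C|) (𝓝 0) (𝓝 0) :=
    Continuous.tendsto' (by fun_prop) 0 0 (by simp)
  filter_upwards [hlim.eventually_lt_const one_pos] with t ht
  have hpos (x : X) : 0 < 1 - t * k x := by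
    have hle : t * k x ≤ |t| * |C| := (le_abs_self _).trans <| (abs_mul t (k x)).trans_le <|
      mul_le_mul_of_nonneg_left ((hC x).trans (le_abs_self C)) (abs_nonneg t)
    linarith
  exact ⟨hh.continuous.div (by fun_prop) fun x => (hpos x).ne',
    fun x => div_pos (hh.pos x) (hpos x)⟩

theorem hasDerivAt_integral_reciprocalVariation [MeasurableSpace X] [OpensMeasurableSpace X]
    {ν : Measure X} [IsFiniteMeasure ν] (hh : IsPosCont h) (hk : Continuous k) {φ φ' : ℝ → ℝ}
    (hφ' : ContinuousOn φ' (Ioi 0)) (hd : ∀ s > 0, HasDerivAt φ (φ' s) s) :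
    HasDerivAt (fun t => ∫ x, φ (reciprocalVariation h k t x) ∂ν)
      (∫ x, h x * φ' (h x) * k x ∂ν) 0 := by
  have hφ : ContinuousOn φ (Ioi 0) := fun s hs => (hd s hs).continuousAt.continuousWithinAt
  have hkh : Continuous fun x => k x / h x := hk.div hh.continuous fun x => (hh.pos x).ne'
  obtain ⟨M, hM⟩ := exists_forall_abs_le hkh
  convert hasDerivAt_integral_comp_inv (ν := ν) (D := fun t x => (1 - t * k x) / h x) (κ := k)
    (continuousOn_uncurry_const hφ) (continuousOn_uncurry_const hφ') (fun s hs _ => hd s hs)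
    (fun t => .div (by fun_prop) hh.continuous fun x => (hh.pos x).ne') (M := M)
    (fun t s x => ?_) (fun x => ?_) hk.aestronglyMeasurable
    (Eventually.of_forall fun x => ?_) using 3 with t
  · simp only [reciprocalVariation, inv_div]
  · simp
  · rw [show (1 - t * k x) / h x - (1 - s * k x) / h x = -(k x / h x * (t - s)) by ring, abs_neg,
      abs_mul]
    exact mul_le_mul_of_nonneg_right (hM x) (abs_nonneg _)
  · simpa using hh.pos x
  · exact (((hasDerivAt_mul_const (k x)).const_sub 1).div_const (h x)).congr_deriv (by ring)

end ReciprocalVariation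

theorem gauge_wulffSet_reciprocalVariation [Nonempty (Sph n)] {h k : Sph n → ℝ} {t : ℝ}
    (ht : IsPosCont (reciprocalVariation h k t)) (x : E n) :
    gauge (wulffSet (reciprocalVariation h k t)) x =
      ⨆ v : Sph n, inner ℝ x (v : E n) / h v + t * (-(k v * (inner ℝ x (v : E n) / h v))) := by
  rw [gauge_wulffSet ht]
  refine iSup_congr fun v => ?_
  rw [reciprocalVariation, div_div_eq_mul_div]
  ring

namespace IsKo

variable {K : ConvexBody (E n)}

theorem hasDerivAt_gauge_reciprocalVariation (hK : IsKo K) {k : Sph n → ℝ} (hk : Continuous k)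
    {u : Sph n} (hu : DifferentiableAt ℝ (gauge K) (u : E n)) :
    HasDerivAt (fun t => ⨆ v : Sph n, inner ℝ (u : E n) (v : E n) / suppFun K (v : E n) +
        t * (-(k v * (inner ℝ (u : E n) (v : E n) / suppFun K (v : E n)))))
      (-(gauge K (u : E n) * k (radGauss K u))) 0 := by
  have : Nonempty (Sph n) := ⟨u⟩
  have hmax {v : Sph n} : inner ℝ (u : E n) (v : E n) / suppFun K (v : E n) = gauge K (u : E n) ↔
      v = radGauss K u := by
    rw [div_eq_iff (hK.suppFun_pos v).ne', ← hK.mem_radGaussSet_singleton,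
      hK.radGaussSet_singleton hu, mem_singleton_iff]
  have hα := hmax.2 rfl
  have hq := hK.continuous_inner_div_suppFun u
  have hb : Continuous fun v : Sph n =>
      -(k v * (inner ℝ (u : E n) (v : E n) / suppFun K (v : E n))) := (hk.mul hq).neg
  refine (hasDerivAt_iSup_add_mul hq hb (x₀ := radGauss K u) (hα.trans (hK.gauge_eq_iSup u))
    fun v hv => hmax.1 (hv.trans hα)).congr_deriv ?_
  rw [hα, mul_comm]

theorem hasDerivAt_dualVol_reciprocalVariation [Nonempty (Sph n)] (hK : IsKo K)
    {k : Sph n → ℝ} (hk : Continuous k) {G G' : ℝ → Sph n → ℝ}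
    (hG : ContinuousOn (Function.uncurry G) (Ioi 0 ×ˢ univ))
    (hG' : ContinuousOn (Function.uncurry G') (Ioi 0 ×ˢ univ))
    (hd : ∀ s > 0, ∀ u, HasDerivAt (fun s => G s u) (G' s u) s) :
    HasDerivAt
      (fun t => dualVol G
        (wulffSet (reciprocalVariation (fun v : Sph n => suppFun K (v : E n)) k t)))
      (∫ u : Sph n, radFun K (u : E n) * G' (radFun K (u : E n)) u * k (radGauss K u)
        ∂(sphMeasure n)) 0 := by
  set D : ℝ → Sph n → ℝ := fun t u => ⨆ v : Sph n,
    inner ℝ (u : E n) (v : E n) / suppFun K (v : E n) +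
      t * (-(k v * (inner ℝ (u : E n) (v : E n) / suppFun K (v : E n))))
  have hD₀ (u : Sph n) : D 0 u = gauge K (u : E n) := by
    simp only [D, zero_mul, add_zero, hK.gauge_eq_iSup]
  have hquot : Continuous fun p : Sph n × Sph n =>
      inner ℝ (p.1 : E n) (p.2 : E n) / suppFun K (p.2 : E n) :=
    .div (by fun_prop) (hK.isPosCont_suppFun.continuous.comp continuous_snd)
      fun p => (hK.suppFun_pos p.2).ne'
  have hb : Continuous fun p : Sph n × Sph n =>
      -(k p.2 * (inner ℝ (p.1 : E n) (p.2 : E n) / suppFun K (p.2 : E n))) :=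
    ((hk.comp continuous_snd).mul hquot).neg
  obtain ⟨M, hM⟩ := exists_forall_abs_le hb
  have hderiv := hasDerivAt_integral_comp_inv (ν := sphMeasure n) (D := D)
    (κ := fun u => k (radGauss K u)) hG hG' hd
    (fun t => continuous_iSup_of_continuous (hquot.add (continuous_const.mul hb)))
    (fun t s u => abs_iSup_add_mul_sub_le (hK.continuous_inner_div_suppFun u)
      (hk.mul (hK.continuous_inner_div_suppFun u)).neg (fun v => hM (u, v)) t s)
    (fun u => hD₀ u ▸ hK.gauge_pos u)
    (hk.measurable.comp_aemeasurable hK.aemeasurable_radGauss).aestronglyMeasurable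
    (by filter_upwards [hK.ae_differentiableAt_gauge] with u hu using
      hD₀ u ▸ hK.hasDerivAt_gauge_reciprocalVariation hk hu)
  simp only [hD₀, ← hK.radFun_eq_inv_gauge] at hderiv
  refine hderiv.congr_of_eventuallyEq ?_
  filter_upwards [eventually_isPosCont_reciprocalVariation hK.isPosCont_suppFun hk] with t ht
  simp only [dualVol, ← coe_wulffBody ht, (isKo_wulffBody ht).radFun_eq_inv_gauge]
  simp only [coe_wulffBody ht, gauge_wulffSet_reciprocalVariation ht, D]

end IsKo

namespace IsMinimizer

variable {K : ConvexBody (E n)} {μ : Measure (Sph n)} [IsFiniteMeasure μ]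
  {G G' : ℝ → Sph n → ℝ} {φ φ' : ℝ → ℝ}

theorem integral_mul_nonneg [Nonempty (Sph n)] (h : IsMinimizer G φ μ K)
    (hG : ContinuousOn (Function.uncurry G) (Ioi 0 ×ˢ univ))
    (hG' : ContinuousOn (Function.uncurry G') (Ioi 0 ×ˢ univ))
    (hGd : ∀ s > 0, ∀ u, HasDerivAt (fun s => G s u) (G' s u) s)
    (hφ' : ContinuousOn φ' (Ioi 0)) (hφd : ∀ s > 0, HasDerivAt φ (φ' s) s)
    (hmono : MonotoneOn φ (Ioi 0))
    {k : Sph n → ℝ} (hk : Continuous k)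
    (hneg : ∫ u : Sph n, radFun K (u : E n) * G' (radFun K (u : E n)) u * k (radGauss K u)
      ∂(sphMeasure n) < 0) :
    0 ≤ ∫ v : Sph n, suppFun K (v : E n) * φ' (suppFun K (v : E n)) * k v ∂μ := by
  by_contra! hlt
  have hK := h.isKo
  have hφ : ContinuousOn φ (Ioi 0) := fun s hs => (hφd s hs).continuousAt.continuousWithinAt
  have hV := eventually_nhdsGT_lt_of_hasDerivAt_neg
    (hK.hasDerivAt_dualVol_reciprocalVariation hk hG hG' hGd) hneg
  have hΦ := eventually_nhdsGT_lt_of_hasDerivAt_neg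
    (hasDerivAt_integral_reciprocalVariation hK.isPosCont_suppFun hk hφ' hφd) hlt
  have hpos := (eventually_isPosCont_reciprocalVariation hK.isPosCont_suppFun hk).filter_mono
    (nhdsWithin_le_nhds (s := Ioi 0))
  obtain ⟨t, hVt, hΦt, ht⟩ := (hV.and (hΦ.and hpos)).exists
  simp only [reciprocalVariation_zero, wulffSet_suppFun] at hVt hΦt
  exact absurd hΦt <| not_lt.2 <| (h.integral_le (wulffBody ht) (isKo_wulffBody ht) hVt.le).trans
    (integral_suppFun_wulffBody_le hφ hmono ht)

theorem exists_multiplier [Nonempty (Sph n)] (h : IsMinimizer G φ μ K)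
    (hG : ContinuousOn (Function.uncurry G) (Ioi 0 ×ˢ univ))
    (hG' : ContinuousOn (Function.uncurry G') (Ioi 0 ×ˢ univ))
    (hGd : ∀ s > 0, ∀ u, HasDerivAt (fun s => G s u) (G' s u) s)
    (hGneg : ∀ s > 0, ∀ u, G' s u < 0)
    (hφ' : ContinuousOn φ' (Ioi 0)) (hφd : ∀ s > 0, HasDerivAt φ (φ' s) s)
    (hmono : MonotoneOn φ (Ioi 0)) :
    ∃ l ≤ 0, ∀ k : Sph n → ℝ, Continuous k →
      ∫ v : Sph n, suppFun K (v : E n) * φ' (suppFun K (v : E n)) * k v ∂μ =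
        l * ∫ u : Sph n, radFun K (u : E n) * G' (radFun K (u : E n)) u * k (radGauss K u)
          ∂(sphMeasure n) := by
  have hK := h.isKo
  have hw : Continuous fun u : Sph n => radFun K (u : E n) * G' (radFun K (u : E n)) u :=
    hK.isPosCont_radFun.continuous.mul (hK.isPosCont_radFun.comp_continuousOn hG')
  have hw' : Continuous fun v : Sph n => suppFun K (v : E n) * φ' (suppFun K (v : E n)) :=
    hK.isPosCont_suppFun.continuous.mul
      (hφ'.comp_continuous hK.isPosCont_suppFun.continuous hK.suppFun_pos)
  set A := integralComp (sphMeasure n) (integrable_of_continuous hw) hK.aemeasurable_radGauss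
  set B := integralComp μ (integrable_of_continuous hw') aemeasurable_id
  have hA : A ≠ 0 := by
    refine DFunLike.ne_iff.2 ⟨1, ne_of_lt ?_⟩
    have hpos : 0 < ∫ u : Sph n, -(radFun K (u : E n) * G' (radFun K (u : E n)) u)
        ∂(sphMeasure n) := by
      have hneg (u : Sph n) : radFun K (u : E n) * G' (radFun K (u : E n)) u < 0 :=
        mul_neg_of_pos_of_neg (hK.isPosCont_radFun.pos u) (hGneg _ (hK.isPosCont_radFun.pos u) u)
      obtain ⟨u⟩ := ‹Nonempty (Sph n)›
      exact integral_pos_of_integrable_nonneg_nonzero hw.neg (integrable_of_continuous hw.neg)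
        (fun v => (neg_pos.2 (hneg v)).le) (neg_pos.2 (hneg u)).ne'
    simpa [A, integralComp, integral_neg] using hpos
  obtain ⟨l, hl, hB⟩ := exists_nonpos_eq_smul (B := B) hA fun k hk =>
    h.integral_mul_nonneg hG hG' hGd hφ' hφd hmono k.continuous hk
  exact ⟨l, hl, fun k hk => DFunLike.congr_fun hB ⟨k, hk⟩⟩

end IsMinimizer

theorem IsKo.measureReal_eq_mul_curvMeasure [Nonempty (Sph n)] {K : ConvexBody (E n)} (hK : IsKo K)
    {μ : Measure (Sph n)} [IsFiniteMeasure μ] {G : ℝ → Sph n → ℝ} {ψ : ℝ → ℝ}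
    (hG' : ContinuousOn (Function.uncurry (partialT G)) (Ioi 0 ×ˢ univ))
    (hneg : ∀ t > 0, ∀ u, partialT G t u < 0) (hψ : ContinuousOn ψ (Ioi 0))
    (hψ0 : ∀ t > 0, 0 < ψ t) {l : ℝ} (hl : l ≤ 0)
    (h : ∀ k : Sph n → ℝ, Continuous k → ∫ v : Sph n, ψ (suppFun K (v : E n)) * k v ∂μ =
      l * ∫ u : Sph n, radFun K (u : E n) * partialT G (radFun K (u : E n)) u * k (radGauss K u)
        ∂(sphMeasure n)) {A : Set (Sph n)} (hA : MeasurableSet A) :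
    μ.real A = l * n * curvMeasure G ψ K A := by
  have hψpos (v : Sph n) : 0 < ψ (suppFun K (v : E n)) := hψ0 _ (hK.suppFun_pos v)
  have hψinv : Continuous fun v : Sph n => (ψ (suppFun K (v : E n)))⁻¹ :=
    (hψ.comp_continuous hK.isPosCont_suppFun.continuous hK.suppFun_pos).inv₀
      fun v => (hψpos v).ne'
  set w : Sph n → ℝ := fun u => l * (radFun K (u : E n) * partialT G (radFun K (u : E n)) u /
    ψ (suppFun K (radGauss K u : E n)))
  have hw : Integrable w (sphMeasure n) := by
    obtain ⟨C, hC⟩ := exists_forall_abs_le hψinv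
    have hρ := integrable_of_continuous (ν := sphMeasure n) <|
      hK.isPosCont_radFun.continuous.mul (hK.isPosCont_radFun.comp_continuousOn hG')
    exact (hρ.mul_bdd (hψinv.measurable.comp_aemeasurable
      hK.aemeasurable_radGauss).aestronglyMeasurable
      (Eventually.of_forall fun u => hC (radGauss K u))).const_mul l
  have hw0 (u : Sph n) : 0 ≤ w u :=
    mul_nonneg_of_nonpos_of_nonpos hl <| div_nonpos_of_nonpos_of_nonneg
      (mul_nonpos_of_nonneg_of_nonpos (hK.isPosCont_radFun.pos u).le
        (hneg _ (hK.isPosCont_radFun.pos u) u).le) (hψpos _).le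
  rw [measureReal_eq_setIntegral_preimage hK.aemeasurable_radGauss hw hw0 (fun g => ?_) hA,
    ← setIntegral_congr_set (hK.revRadGaussSet_ae_eq A), curvMeasure, integral_const_mul]
  · have := dim_ne_zero (n := n)
    field_simp
  · have hk : Continuous fun v : Sph n => (ψ (suppFun K (v : E n)))⁻¹ * g v :=
      hψinv.mul g.continuous
    calc ∫ v, g v ∂μ
        = ∫ v : Sph n, ψ (suppFun K (v : E n)) * ((ψ (suppFun K (v : E n)))⁻¹ * g v) ∂μ := by
          simp only [mul_inv_cancel_left₀ (hψpos _).ne']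
      _ = _ := by
          rw [h _ hk, ← integral_const_mul]
          refine integral_congr_ae (Eventually.of_forall fun u => ?_)
          simp only [w]
          ring

theorem exists_isKo_measureReal_eq_mul_curvMeasure {μ : Measure (Sph n)} [IsFiniteMeasure μ]
    (hμ0 : μ ≠ 0) (hμ : NotConcentrated μ) {G : ℝ → Sph n → ℝ} {ψ : ℝ → ℝ} {ε : ℝ}
    (hG : ContinuousOn (Function.uncurry G) (Ioi 0 ×ˢ univ))
    (hGd : ∀ t > 0, ∀ u, DifferentiableAt ℝ (fun s => G s u) t)
    (hG' : ContinuousOn (Function.uncurry (partialT G)) (Ioi 0 ×ˢ univ))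
    (hneg : ∀ t > 0, ∀ u, partialT G t u < 0) (hε : 0 < ε)
    (hcap : ∀ v, Tendsto (fun t => ∫ u in cap ε v, G t u ∂(sphMeasure n)) (𝓝[>] 0) atTop)
    (hinf : Tendsto (fun t => ∫ u, G t u ∂(sphMeasure n)) atTop (𝓝 0))
    (hψ : ContinuousOn ψ (Ioi 0)) (hψ0 : ∀ t > 0, 0 < ψ t)
    (hint : ∫⁻ s in Ioi (1 : ℝ), ENNReal.ofReal (ψ s / s) = ⊤) :
    ∃ K : ConvexBody (E n), IsKo K ∧ ∃ c : ℝ, ∀ A : Set (Sph n), MeasurableSet A →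
      μ.real A = c * curvMeasure G ψ K A := by
  have := nonempty_sph_of_ne_zero hμ0
  have hanti (u : Sph n) : AntitoneOn (fun t => G t u) (Ioi 0) :=
    antitoneOn_of_deriv_nonpos (convex_Ioi 0)
      (fun t ht => (hGd t ht u).continuousAt.continuousWithinAt)
      (fun t ht => (hGd t (interior_subset ht) u).differentiableWithinAt)
      fun t ht => (hneg t (interior_subset ht) u).le
  set φ : ℝ → ℝ := fun t => ∫ s in (1 : ℝ)..t, ψ s / s
  have hψs : ContinuousOn (fun s => ψ s / s) (Ioi 0) :=
    hψ.div continuousOn_id fun s hs => ne_of_gt hs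
  have hφd (t : ℝ) (ht : t > 0) : HasDerivAt φ (ψ t / t) t :=
    hasDerivAt_intervalIntegral isOpen_Ioi ordConnected_Ioi hψs (mem_Ioi.2 one_pos) ht
  have hφ : ContinuousOn φ (Ioi 0) := fun t ht => (hφd t ht).continuousAt.continuousWithinAt
  have hmono : MonotoneOn φ (Ioi 0) :=
    monotoneOn_of_hasDerivWithinAt_nonneg (f' := fun t => ψ t / t) (convex_Ioi 0) hφ
      (fun t ht => (hφd t (interior_subset ht)).hasDerivWithinAt) fun t ht =>
        have ht : 0 < t := interior_subset ht
        (div_pos (hψ0 t ht) ht).le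
  have htop : Tendsto φ atTop atTop :=
    tendsto_intervalIntegral_atTop (hψs.mono fun s hs => one_pos.trans_le (mem_Ici.1 hs))
      (fun s hs => (div_pos (hψ0 s (one_pos.trans hs)) (one_pos.trans hs)).le) hint
  obtain ⟨K, hK⟩ := exists_isMinimizer hμ hG hanti hinf hε hcap hφ hmono htop
  obtain ⟨l, hl, hlagrange⟩ := hK.exists_multiplier hG hG' (fun t ht u => (hGd t ht u).hasDerivAt)
    hneg hψs hφd hmono
  simp only [mul_div_cancel₀ _ (hK.isKo.suppFun_pos _).ne'] at hlagrange
  exact ⟨K, hK.isKo, l * n,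
    fun A => hK.isKo.measureReal_eq_mul_curvMeasure hG' hneg hψ hψ0 hl hlagrange⟩

/-! ### Dilations and the `(p,q)`-dual curvature measure -/

namespace IsKo

variable {K : ConvexBody (E n)} {s : ℝ}

theorem smul (hK : IsKo K) (hs : 0 < s) : IsKo (s • K) := by
  rw [IsKo, ConvexBody.coe_smul, interior_smul₀ hs.ne', mem_smul_set_iff_inv_smul_mem₀ hs.ne',
    smul_zero]
  exact hK

theorem radFun_smul (hK : IsKo K) (hs : 0 < s) (u : Sph n) :
    radFun ↑(s • K) (u : E n) = s * radFun K (u : E n) := by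
  rw [(hK.smul hs).radFun_eq_inv_gauge, hK.radFun_eq_inv_gauge, ConvexBody.coe_smul,
    gauge_smul_left_of_nonneg hs.le, Pi.smul_apply, smul_eq_mul, mul_inv, inv_inv]

theorem radGaussSet_singleton_smul (hK : IsKo K) (hs : 0 < s) (u : Sph n) :
    radGaussSet ↑(s • K) {u} = radGaussSet K {u} := by
  ext v
  rw [(hK.smul hs).mem_radGaussSet_singleton, hK.mem_radGaussSet_singleton, ConvexBody.coe_smul,
    gauge_smul_left_of_nonneg hs.le, suppFun_smul hs.le, Pi.smul_apply, smul_eq_mul,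
    mul_mul_mul_comm, inv_mul_cancel₀ hs.ne', one_mul]

theorem radGauss_smul (hK : IsKo K) (hs : 0 < s) : radGauss ↑(s • K) = radGauss (n := n) K := by
  ext1 u
  rw [radGauss, radGauss, hK.radGaussSet_singleton_smul hs]

theorem revRadGaussSet_smul (hK : IsKo K) (hs : 0 < s) (A : Set (Sph n)) :
    revRadGaussSet ↑(s • K) A = revRadGaussSet K A := by
  ext u
  rw [(hK.smul hs).mem_revRadGaussSet, hK.mem_revRadGaussSet, hK.radGaussSet_singleton_smul hs]

theorem pqCurvMeasure_smul (hK : IsKo K) (hs : 0 < s) (p q : ℝ) (Q : Set (E n))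
    (A : Set (Sph n)) :
    pqCurvMeasure p q ↑(s • K) Q A = s ^ (q - p) * pqCurvMeasure p q K Q A := by
  rw [pqCurvMeasure, pqCurvMeasure, mul_left_comm, ← integral_const_mul (s ^ (q - p)),
    hK.revRadGaussSet_smul hs, hK.radGauss_smul hs]
  refine congrArg _ (integral_congr_ae (Eventually.of_forall fun u => ?_))
  beta_reduce
  rw [hK.radFun_smul hs, ConvexBody.coe_smul, suppFun_smul hs.le,
    Real.mul_rpow hs.le (hK.suppFun_pos _).le, Real.mul_rpow hs.le (hK.isPosCont_radFun.pos u).le,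
    sub_eq_neg_add q, Real.rpow_add hs]
  ring

end IsKo

theorem setIntegral_cap_pos {w : Sph n → ℝ} (hw : IsPosCont w) {ε : ℝ} (hε : ε < 1) (v : Sph n) :
    0 < ∫ u in cap ε v, w u ∂(sphMeasure n) := by
  rw [setIntegral_pos_iff_support_of_nonneg_ae (Eventually.of_forall fun u => (hw.pos u).le)
    (integrable_of_continuous hw.continuous).integrableOn, Function.support_eq_univ fun u =>
      (hw.pos u).ne', univ_inter]
  have hopen : IsOpen {u : Sph n | ε < inner ℝ (u : E n) (v : E n)} :=
    isOpen_lt continuous_const (by fun_prop)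
  refine (hopen.measure_pos (sphMeasure n) ⟨v, ?_⟩).trans_le (measure_mono fun u hu => ?_)
  · rwa [mem_ofPred_eq, inner_sph_self]
  · exact le_of_lt (mem_ofPred_eq ▸ hu)

theorem partialT_rpow_mul (q : ℝ) (b : Sph n → ℝ) {t : ℝ} (ht : 0 < t) (u : Sph n) :
    partialT (fun s u => s ^ q * b u) t u = q * t ^ (q - 1) * b u :=
  ((Real.hasDerivAt_rpow_const (Or.inl ht.ne')).mul_const (b u)).deriv

theorem IsKo.curvMeasure_rpow_eq_mul_pqCurvMeasure {K : ConvexBody (E n)} (hK : IsKo K) (p q : ℝ)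
    (Q : Set (E n)) (A : Set (Sph n)) :
    curvMeasure (fun s u => s ^ q * radFun Q (u : E n) ^ ((n : ℝ) - q)) (fun t => t ^ p) K A =
      q * pqCurvMeasure p q K Q A := by
  rw [curvMeasure, pqCurvMeasure, mul_left_comm, ← integral_const_mul q]
  refine congrArg _ (integral_congr_ae (Eventually.of_forall fun u => ?_))
  have hρ := hK.isPosCont_radFun.pos u
  simp only [partialT_rpow_mul q _ hρ, Real.rpow_neg (hK.suppFun_pos _).le,
    Real.rpow_sub_one hρ.ne']
  field_simp

theorem IsKo.pqCurvMeasure_nonneg {K : ConvexBody (E n)} (hK : IsKo K) (p q : ℝ) {Q : Set (E n)}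
    (hQ : ∀ u : Sph n, 0 ≤ radFun Q (u : E n)) (A : Set (Sph n)) : 0 ≤ pqCurvMeasure p q K Q A :=
  mul_nonneg (by positivity) <| integral_nonneg fun u =>
    mul_nonneg (mul_nonneg (Real.rpow_nonneg (hK.suppFun_pos _).le _)
      (Real.rpow_nonneg (hK.isPosCont_radFun.pos u).le _)) (Real.rpow_nonneg (hQ u) _)

theorem exists_isKo_measureReal_eq_mul_pqCurvMeasure {μ : Measure (Sph n)} [IsFiniteMeasure μ]
    (hμ0 : μ ≠ 0) (hμ : NotConcentrated μ) {p q : ℝ} (hp : 0 < p) (hq : q < 0) {Q : Set (E n)}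
    (hQ : IsStarBody Q) :
    ∃ K : ConvexBody (E n), IsKo K ∧ ∃ c > 0, ∀ A : Set (Sph n), MeasurableSet A →
      μ.real A = c * pqCurvMeasure p q K Q A := by
  set b : Sph n → ℝ := fun u => radFun Q (u : E n) ^ ((n : ℝ) - q)
  have hb : IsPosCont b :=
    ⟨hQ.radFun_cont.rpow_const fun u => Or.inl (hQ.radFun_pos u).ne',
      fun u => Real.rpow_pos_of_pos (hQ.radFun_pos u) _⟩
  have hpow (a : ℝ) : ContinuousOn (fun x : ℝ × Sph n => x.1 ^ a) (Ioi 0 ×ˢ univ) :=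
    continuousOn_fst.rpow_const fun x hx => Or.inl (ne_of_gt hx.1)
  have hb' : ContinuousOn (fun x : ℝ × Sph n => b x.2) (Ioi 0 ×ˢ univ) :=
    (hb.continuous.comp continuous_snd).continuousOn
  obtain ⟨K, hK, c, hc⟩ := exists_isKo_measureReal_eq_mul_curvMeasure hμ0 hμ (ε := 1 / 2)
    (G := fun s u => s ^ q * b u) (ψ := fun t => t ^ p) ((hpow q).mul hb')
    (fun t ht u => (Real.differentiableAt_rpow_const_of_ne q ht.ne').mul_const _)
    (((continuousOn_const.mul (hpow (q - 1))).mul hb').congr fun x hx =>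
      partialT_rpow_mul q b hx.1 x.2)
    (fun t ht u => by
      rw [partialT_rpow_mul q b ht]
      exact mul_neg_of_neg_of_pos (mul_neg_of_neg_of_pos hq (Real.rpow_pos_of_pos ht _)) (hb.pos u))
    one_half_pos
    (fun v => by
      simp only [integral_const_mul]
      exact (tendsto_rpow_neg_nhdsGT_zero hq).atTop_mul_const
        (setIntegral_cap_pos hb one_half_lt_one v))
    (by
      simpa [integral_const_mul] using
        (tendsto_rpow_neg_atTop (neg_pos.2 hq)).mul_const (∫ u, b u ∂(sphMeasure n)))
    (continuousOn_id.rpow_const fun t ht => Or.inl (ne_of_gt ht))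
    (fun t ht => Real.rpow_pos_of_pos ht p) (by
      rw [← lintegral_Ioi_rpow_eq_top (a := p - 1) (by linarith) one_pos]
      refine setLIntegral_congr_fun measurableSet_Ioi fun s hs => ?_
      simp only [Real.rpow_sub_one (one_pos.trans (mem_Ioi.1 hs)).ne'])
  simp only [b, hK.curvMeasure_rpow_eq_mul_pqCurvMeasure p q Q, ← mul_assoc c q] at hc
  refine ⟨K, hK, c * q, ?_, hc⟩
  have : NeZero μ := ⟨hμ0⟩
  have huniv : 0 < μ.real univ := measureReal_univ_pos
  rw [hc univ MeasurableSet.univ] at huniv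
  exact pos_of_mul_pos_left huniv (hK.pqCurvMeasure_nonneg p q (fun u => (hQ.radFun_pos u).le) univ)

theorem exists_isKo_measureReal_eq_pqCurvMeasure {μ : Measure (Sph n)} [IsFiniteMeasure μ]
    (hμ0 : μ ≠ 0) (hμ : NotConcentrated μ) {p q : ℝ} (hp : 0 < p) (hq : q < 0) {Q : Set (E n)}
    (hQ : IsStarBody Q) :
    ∃ K : ConvexBody (E n), IsKo K ∧ ∀ A : Set (Sph n), MeasurableSet A →
      μ.real A = pqCurvMeasure p q K Q A := by
  obtain ⟨K, hK, c, hc, hμK⟩ := exists_isKo_measureReal_eq_mul_pqCurvMeasure hμ0 hμ hp hq hQ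
  have hs : 0 < c ^ (q - p)⁻¹ := Real.rpow_pos_of_pos hc _
  refine ⟨c ^ (q - p)⁻¹ • K, hK.smul hs, fun A hA => ?_⟩
  rw [hK.pqCurvMeasure_smul hs, Real.rpow_inv_rpow hc.le (by linarith), hμK A hA]

end DualOrlicz

end

theorem mainTheorem1 (n : ℕ) (μ : Measure (DualOrlicz.Sph n)) [IsFiniteMeasure μ]
    (hμ0 : μ ≠ 0) (hμ : DualOrlicz.NotConcentrated μ) :
    -- the general dual Orlicz Minkowski problem
    (∀ (G : ℝ → DualOrlicz.Sph n → ℝ) (ψ : ℝ → ℝ) (ε₀ : ℝ),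
      ContinuousOn (fun p : ℝ × DualOrlicz.Sph n => G p.1 p.2) (Ioi 0 ×ˢ univ) →
      (∀ t > 0, ∀ u, DifferentiableAt ℝ (fun s => G s u) t) →
      ContinuousOn (fun p : ℝ × DualOrlicz.Sph n => DualOrlicz.partialT G p.1 p.2)
        (Ioi 0 ×ˢ univ) →
      (∀ t > 0, ∀ u, DualOrlicz.partialT G t u < 0) →
      0 < ε₀ → ε₀ < 1 →
      (∀ v : DualOrlicz.Sph n, ∀ ε : ℝ, 0 < ε → ε ≤ ε₀ →
        Tendsto (fun t => ∫ u in DualOrlicz.cap ε v, G t u ∂(DualOrlicz.sphMeasure n))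
          (𝓝[>] 0) atTop) →
      Tendsto (fun t => ∫ u, G t u ∂(DualOrlicz.sphMeasure n)) atTop (𝓝 0) →
      ContinuousOn ψ (Ioi 0) →
      (∀ t > 0, 0 < ψ t) →
      ∫⁻ s in Ioi (1 : ℝ), ENNReal.ofReal (ψ s / s) = ⊤ →
      ∃ K : ConvexBody (DualOrlicz.E n), DualOrlicz.IsKo K ∧
        DualOrlicz.curvMeasure G ψ K univ ≠ 0 ∧
        ∀ A : Set (DualOrlicz.Sph n), MeasurableSet A →
          μ.real A / μ.real univ =
            DualOrlicz.curvMeasure G ψ K A / DualOrlicz.curvMeasure G ψ K univ) ∧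
    -- the `(p,q)`-dual Minkowski problem for `p > 0` and `q < 0`
    (∀ (p q : ℝ) (Q : Set (DualOrlicz.E n)), 0 < p → q < 0 → DualOrlicz.IsStarBody Q →
      ∃ K : ConvexBody (DualOrlicz.E n), DualOrlicz.IsKo K ∧
        ∀ A : Set (DualOrlicz.Sph n), MeasurableSet A →
          μ.real A = DualOrlicz.pqCurvMeasure p q K Q A) := by
  have hμpos : 0 < μ.real univ := have : NeZero μ := ⟨hμ0⟩; measureReal_univ_pos
  refine ⟨fun G ψ ε₀ hG hGd hG' hneg hε₀ _ hcap hinf hψ hψ0 hint => ?_,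
    fun p q Q hp hq hQ => DualOrlicz.exists_isKo_measureReal_eq_pqCurvMeasure hμ0 hμ hp hq hQ⟩
  obtain ⟨K, hK, c, hc⟩ := DualOrlicz.exists_isKo_measureReal_eq_mul_curvMeasure hμ0 hμ hG hGd hG'
    hneg hε₀ (fun v => hcap v ε₀ hε₀ le_rfl) hinf hψ hψ0 hint
  have hcK := hc univ MeasurableSet.univ ▸ hμpos.ne'
  refine ⟨K, hK, right_ne_zero_of_mul hcK, fun A hA => ?_⟩
  rw [hc univ MeasurableSet.univ, hc A hA, mul_div_mul_left _ _ (left_ne_zero_of_mul hcK)]
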